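/- Let $n,r\in\mathbb N$, let $b_{i,j}\in\mathbb R^n$ ($1\le i\le r$, $j\in\{1,2\}$) be constant vectors, let $\omega_1,\dots,\omega_r$ be pairwise distinct positive rational numbers, let $b_0:\mathbb R^n\to\mathbb R^n$, and let $J:\mathbb R^n\to\mathbb R$ be a radially unbounded $C^2$ function. For $\varepsilon>0$ consider the system $$\dot{\tilde x}=b_0(\tilde x+x^\star)+\varepsilon^{-1}\sum_{i=1}^r\sum_{j=1}^2 b_{i,j}\,u_{i,j}(J(\tilde x+x^\star),\tau),\qquad \dot\tau=\varepsilon^{-2},\qquad(\ast)$$ with $(\tilde x,\tau)\in\mathbb R^n\times[0,\infty)$ and the feedback law $$u_{i,1}(y,\tau)=\sqrt{2\omega_i y}\,\cos(\ln y+\omega_i\tau),\quad u_{i,2}(y,\tau)=\sqrt{2\omega_i y}\,\sin(\ln y+\omega_i\tau)\quad\text{for }y>0,$$ $u_{i,1}(y,\tau)=u_{i,2}(y,\tau)=0$ for $y\le 0$. Assume that there are a point $x^\star\in\mathbb R^n$, constants $\gamma>\kappa_3>0$, $L_J>0$, $L_0>0$ and a class $\mathcal K$ function $\alpha_J$ such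 that - $\sum_{i=1}^r\sum_{j=1}^2(b_{i,j}^\top v)^2\ge\gamma|v|^2$ for all $v\in\mathbb R^n$; - $J(x)>J(x^\star)$ for all $x\ne x^\star$, and $\nabla J(x)=0$ if and only if $x=x^\star$; - $|\nabla^2J(x)|\le L_J$ for all $x$; - $|b_0(x)|\le\kappa_3|\nabla J(x)|$ for all $x$, and $|b_0(x_1)-b_0(x_2)|\le L_0|x_1-x_2|$ for all $x_1,x_2$; - $\alpha_J(|x-x^\star|)^2\,|x-x^\star|^2\le|\nabla J(x)|^2$ for all $x$. Write $J^\star=J(x^\star)=\min J$. Then: (a) The origin is uniformly globally ultimately bounded for $(\ast)$: there are $\Delta>0$, $\beta\in\mathcal{KL}$ and $\varepsilon^*>0$ such that, for all $\varepsilon\in(0,\varepsilon^*)$, every solution of $(\ast)$ from any initial condition $(\tilde x_0,\tau_0)\in\mathbb R^n\times[0,\infty)$ satisfies $|\tilde x(t)|\le\beta(|\tilde x_0|,t)+\Delta$ for all $t\ge 0$ in its domain, and every maximal solution is defined on all of $[0,\infty)$. (b) If $J^\star\ge 0$, then the origin is uniformly globally practically asymptotically stable (UGpAS) for $(\ast)$: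 there is $\beta\in\mathcal{KL}$ such that for every $\nu>0$ there is $\varepsilon^*>0$ such that, for all $\varepsilon\in(0,\varepsilon^*)$, every solution of $(\ast)$ from any initial condition $(\tilde x_0,\tau_0)\in\mathbb R^n\times[0,\infty)$ satisfies $|\tilde x(t)|\le\beta(|\tilde x_0|,t)+\nu$ for all $t\ge 0$ in its domain, and every maximal solution is defined on all of $[0,\infty)$. Here a solution is a $C^1$ function on an interval $[0,t_s)$, $0<t_s\le\infty$, that satisfies the equations there (uniqueness is not required). A class $\mathcal K$ function is a continuous strictly increasing $\alpha:[0,\infty)\to[0,\infty)$ with $\alpha(0)=0$, and it is of class $\mathcal K_\infty$ if moreover $\alpha(s)\to\infty$ as $s\to\infty$. A class $\mathcal{KL}$ function is a continuous $\beta:[0,\infty)^2\to[0,\infty)$ such that $\beta(\cdot,s)$ is of class $\mathcal K_\infty$ for every $s\ge0$, $\beta(r,\cdot)$ is strictly decreasing for every $r>0$, and $\beta(r,s)\to0$ as $s\to\infty$ for every $r\ge0$. -/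

import Mathlib

namespace ExtremumSeeking

/-- A class `K` function on `[0, ∞)`: continuous, strictly increasing, zero at zero (only the
values on `[0, ∞)` matter; there they are nonnegative automatically). -/
structure IsClassK (α : ℝ → ℝ) : Prop where
  continuousOn : ContinuousOn α (Set.Ici 0)
  strictMonoOn : StrictMonoOn α (Set.Ici 0)
  map_zero : α 0 = 0

/-- A class `K_∞` function on `[0, ∞)`. -/
structure IsClassKInf (α : ℝ → ℝ) : Prop extends IsClassK α where
  tendsto_atTop : Filter.Tendsto α Filter.atTop Filter.atTop

/-- A class `KL` function on `[0, ∞) × [0, ∞)`: continuous, of class `K_∞` in the first argument,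
and decreasing to `0` in the second one. The decrease is strict for `r > 0`; at `r = 0` the
function `β 0` vanishes identically on `[0, ∞)`. -/
structure IsClassKL (β : ℝ → ℝ → ℝ) : Prop where
  continuousOn : ContinuousOn (fun p : ℝ × ℝ => β p.1 p.2) (Set.Ici 0 ×ˢ Set.Ici 0)
  classKInf : ∀ s, 0 ≤ s → IsClassKInf (fun r => β r s)
  strictAntiOn : ∀ r, 0 < r → StrictAntiOn (β r) (Set.Ici 0)
  tendsto_zero : ∀ r, 0 ≤ r → Filter.Tendsto (β r) Filter.atTop (nhds 0)

/-- The interval `[0, T)`, where `T` may be `∞`. -/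
def timeDomain (T : EReal) : Set ℝ := {t : ℝ | 0 ≤ t ∧ (t : EReal) < T}

section Systems

variable {E : Type*} [NormedAddCommGroup E] [NormedSpace ℝ E]

/-- `(x, τ)` is a solution on `[0, T)`, `0 < T ≤ ∞`, from the initial condition `(x₀, τ₀)`, of
`x' = f ε x τ`, `τ' = ε⁻²`. Derivatives are one-sided at `t = 0` and two-sided elsewhere.
For continuous `f ε` the derivatives are automatically continuous. -/
structure IsSolution (f : ℝ → E → ℝ → E) (ε : ℝ) (x₀ : E) (τ₀ : ℝ)
    (T : EReal) (x : ℝ → E) (τ : ℝ → ℝ) : Prop where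
  pos : 0 < T
  init_x : x 0 = x₀
  init_τ : τ 0 = τ₀
  deriv_x : ∀ t ∈ timeDomain T, HasDerivWithinAt x (f ε (x t) (τ t)) (timeDomain T) t
  deriv_τ : ∀ t ∈ timeDomain T, HasDerivWithinAt τ ((ε ^ 2)⁻¹) (timeDomain T) t

/-- A solution on `[0, T)` is maximal if no solution extends it to a longer interval. -/
def IsMaximalSolution (f : ℝ → E → ℝ → E) (ε : ℝ) (x₀ : E) (τ₀ : ℝ)
    (T : EReal) (x : ℝ → E) (τ : ℝ → ℝ) : Prop :=
  IsSolution f ε x₀ τ₀ T x τ ∧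
    ∀ (T' : EReal) (x' : ℝ → E) (τ' : ℝ → ℝ), IsSolution f ε x₀ τ₀ T' x' τ' →
      (∀ t ∈ timeDomain T, x' t = x t ∧ τ' t = τ t) → T' ≤ T

/-- Every solution of the system with parameter `ε`, from any initial condition `(x₀, τ₀)` with
`τ₀ ≥ 0`, satisfies `‖x t‖ ≤ β ‖x₀‖ t + c` as long as it is defined, and every maximal solution
is complete, i.e. defined on `[0, ∞)`. -/
def SolutionsBounded (f : ℝ → E → ℝ → E) (ε : ℝ) (β : ℝ → ℝ → ℝ) (c : ℝ) : Prop :=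
  ∀ (x₀ : E) (τ₀ : ℝ), 0 ≤ τ₀ → ∀ (T : EReal) (x : ℝ → E) (τ : ℝ → ℝ),
    (IsSolution f ε x₀ τ₀ T x τ → ∀ t ∈ timeDomain T, ‖x t‖ ≤ β ‖x₀‖ t + c) ∧
    (IsMaximalSolution f ε x₀ τ₀ T x τ → T = ⊤)

/-- The origin is uniformly globally practically asymptotically stable. -/
def UGpAS (f : ℝ → E → ℝ → E) : Prop :=
  ∃ β : ℝ → ℝ → ℝ, IsClassKL β ∧ ∀ ν : ℝ, 0 < ν → ∃ εs : ℝ, 0 < εs ∧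
    ∀ ε : ℝ, 0 < ε → ε < εs → SolutionsBounded f ε β ν

/-- The origin is uniformly globally ultimately bounded. -/
def UGUB (f : ℝ → E → ℝ → E) : Prop :=
  ∃ Δ : ℝ, 0 < Δ ∧ ∃ β : ℝ → ℝ → ℝ, IsClassKL β ∧ ∃ εs : ℝ, 0 < εs ∧
    ∀ ε : ℝ, 0 < ε → ε < εs → SolutionsBounded f ε β Δ

end Systems

/-- The feedback law, as a function of the cost value `y` and of `τ`: for `y > 0` it is
`√(2 ω y) cos (ln y + ω τ)` (`j = 0`) or `√(2 ω y) sin (ln y + ω τ)` (`j = 1`); it vanishes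
for `y ≤ 0`. -/
noncomputable def feedback (ω : ℝ) (j : Fin 2) (y τ : ℝ) : ℝ :=
  if 0 < y then
    Real.sqrt (2 * ω * y) *
      (if j = 0 then Real.cos (Real.log y + ω * τ) else Real.sin (Real.log y + ω * τ))
  else 0

/-- The right-hand side of the closed-loop extremum seeking system in the shifted coordinate
`x - xs`. -/
noncomputable def closedLoop {n r : ℕ}
    (b₀ : EuclideanSpace ℝ (Fin n) → EuclideanSpace ℝ (Fin n))
    (b : Fin r → Fin 2 → EuclideanSpace ℝ (Fin n)) (ω : Fin r → ℚ)
    (J : EuclideanSpace ℝ (Fin n) → ℝ) (xs : EuclideanSpace ℝ (Fin n))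
    (ε : ℝ) (x : EuclideanSpace ℝ (Fin n)) (τ : ℝ) : EuclideanSpace ℝ (Fin n) :=
  b₀ (x + xs) + ε⁻¹ • ∑ i, ∑ j, feedback (ω i : ℝ) j (J (x + xs)) τ • b i j

end ExtremumSeeking

/-! Write V = J - J*, g = ∇J, u = `inputDir`, P = `responseDir`; the input is ε⁻¹√J u. Subtracting
from x the quantity ε√J `primitiveDir`, where √J `primitiveDir` is the τ-antiderivative of √J u,
cancels the ε⁻¹ term: the new coordinate z obeys z' = b₀ - ⟨u,g⟩P + O(ε√V)
(`hasDerivWithinAt_slow`). The product ⟨u,g⟩⟨P,g⟩ is quadratic in the components of g along rotating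
vectors. Since the frequencies are distinct, its mean is Σ⟨b_ij,g⟩², and its oscillating part is, to
leading order, the derivative of ε²q for an explicit quadratic form q (`exists_isCorrector`). Hence
W = J(z) - J* + ε²q satisfies |W - V| = O(εV) and W' ≤ -(γ - κ₃)|g|² + O(εV)
(`exists_perturbed_lyapunov`).

The errors are relative to V because |g|² ≤ 4LV and √J is comparable to √V on {V ≥ c}, provided J* +
c > 0. This is why the threshold on ε does not depend on the initial condition. It also keeps J > 0
wherever the feedback is differentiated. The gradient growth gives |g|² ≥ α(√(V/L))² V/L, so V
either falls to order c or decays at a rate governed by its current value (`le_or_decay`). Inverting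
the resulting implicit inequality gives a KL bound independent of c and ε.

If J* ≥ 0, every c > 0 is allowed, which gives practical stability; in general c = |J*| + 1 gives an
ultimate bound. Completeness follows from boundedness, with Peano's theorem extending a solution
past a finite endpoint. -/

namespace ExtremumSeeking

/-! ### Peano's existence theorem by Tonelli's delay method. -/

section Peano

open MeasureTheory Filter Topology

variable {E : Type*} [NormedAddCommGroup E] [NormedSpace ℝ E]

/-- Tonelli's delayed Picard iterates for `x' = F t x`, `x 0 = x₀`, with delay `h`. -/
noncomputable def delayedIterate (F : ℝ → E → E) (x₀ : E) (h : ℝ) : ℕ → ℝ → E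
  | 0 => fun _ => x₀
  | m + 1 => fun t => x₀ + ∫ s in (0 : ℝ)..max t 0, F s (delayedIterate F x₀ h m (s - h))

theorem delayedIterate_succ (F : ℝ → E → E) (x₀ : E) (h : ℝ) (m : ℕ) (t : ℝ) :
    delayedIterate F x₀ h (m + 1) t =
      x₀ + ∫ s in (0 : ℝ)..max t 0, F s (delayedIterate F x₀ h m (s - h)) := rfl

variable {F : ℝ → E → E} {M : NNReal}

theorem delayedIterate_lipschitz (hF : Continuous (Function.uncurry F))
    (hM : ∀ t x, ‖F t x‖ ≤ M) (x₀ : E) (h : ℝ) (m : ℕ) :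
    LipschitzWith M (delayedIterate F x₀ h m) := by
  induction m with
  | zero => exact (LipschitzWith.const x₀).weaken (zero_le)
  | succ m ih =>
    have hc : Continuous fun s => F s (delayedIterate F x₀ h m (s - h)) :=
      hF.comp (continuous_id.prodMk (ih.continuous.comp (by fun_prop)))
    refine LipschitzWith.of_dist_le_mul fun s t => ?_
    rw [delayedIterate_succ, delayedIterate_succ, dist_add_left, dist_eq_norm, dist_eq_norm,
      intervalIntegral.integral_interval_sub_left (hc.intervalIntegrable _ _)
      (hc.intervalIntegrable _ _)]
    refine (intervalIntegral.norm_integral_le_of_norm_le_const fun u _ => hM _ _).trans ?_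
    gcongr
    rw [Real.norm_eq_abs]
    exact abs_max_sub_max_le_abs _ _ _

/-- The value at t only uses the previous iterate up to time t - h, so each iteration settles one
more interval of length h. The settled iterate solves the delayed equation exactly. -/
theorem delayedIterate_stable (x₀ : E) {h : ℝ} (hh : 0 ≤ h) (m : ℕ) (t : ℝ) (ht : t ≤ m * h) :
    delayedIterate F x₀ h (m + 1) t = delayedIterate F x₀ h m t := by
  induction m generalizing t with
  | zero =>
    have : t ≤ 0 := by simpa using ht
    simp [delayedIterate, max_eq_right this]
  | succ m ih =>
    rw [delayedIterate_succ, delayedIterate_succ, add_right_inj]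
    refine intervalIntegral.integral_congr fun s hs => ?_
    rw [Set.uIcc_of_le (le_max_right _ _)] at hs
    rw [ih]
    have := hs.2
    push_cast at ht
    rcases le_max_iff.1 this with h1 | h1
    · linarith
    · have : 0 ≤ (m : ℝ) * h := by positivity
      linarith

theorem exists_delayed_solution (hF : Continuous (Function.uncurry F))
    (hM : ∀ t x, ‖F t x‖ ≤ M) (x₀ : E) (k : ℕ) :
    ∃ φ : ℝ → E, LipschitzWith M φ ∧ φ 0 = x₀ ∧ ∀ t ∈ Set.Icc (0 : ℝ) 1,
      φ t = x₀ + ∫ s in (0 : ℝ)..t, F s (φ (s - 1 / ((k : ℝ) + 1))) := by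
  have hk : (0 : ℝ) < (k : ℝ) + 1 := by positivity
  refine ⟨delayedIterate F x₀ (1 / ((k : ℝ) + 1)) (k + 1),
    delayedIterate_lipschitz hF hM x₀ _ _, by simp [delayedIterate], fun t ht => ?_⟩
  -- With delay 1/(k+1), exactly k+1 iterations settle all of [0, 1].
  rw [← delayedIterate_stable x₀ (by positivity) (k + 1) t
    (by push_cast; rw [mul_one_div_cancel hk.ne']; exact ht.2), delayedIterate_succ, max_eq_left ht.1]

/-- Peano's theorem on `[0, 1]` for a bounded continuous right-hand side. -/
theorem exists_solution_of_bounded [ProperSpace E] (hF : Continuous (Function.uncurry F))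
    (hM : ∀ t x, ‖F t x‖ ≤ M) (x₀ : E) :
    ∃ x : ℝ → E, x 0 = x₀ ∧ ∀ t ∈ Set.Icc (0 : ℝ) 1, HasDerivAt x (F t (x t)) t := by
  choose φ hφL hφ0 hφ using exists_delayed_solution hF hM x₀
  let ψ : ℕ → BoundedContinuousFunction (Set.Icc (0 : ℝ) 1) E := fun k =>
    BoundedContinuousFunction.mkOfCompact
      ⟨fun t => φ k t, (hφL k).continuous.comp continuous_subtype_val⟩
  -- The common Lipschitz constant makes this set compact by Arzelà–Ascoli. It also makes the
  -- vanishing delay harmless in the limit.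
  let A : Set (BoundedContinuousFunction (Set.Icc (0 : ℝ) 1) E) :=
    {f | ∀ s t, dist (f s) (f t) ≤ M * dist s t} ∩ {f | ∀ t, f t ∈ Metric.closedBall x₀ M}
  have hA : IsCompact A := by
    refine BoundedContinuousFunction.arzela_ascoli₂ (Metric.closedBall x₀ M)
      (isCompact_closedBall _ _) A ?_ (fun f t hf => hf.2 t) ?_
    · have h1 : ∀ t, Continuous fun f : BoundedContinuousFunction (Set.Icc (0 : ℝ) 1) E => f t :=
        fun t => (BoundedContinuousFunction.lipschitz_eval_const t).continuous
      refine IsClosed.inter ?_ ?_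
      · simp only [Set.ofPred_forall]
        exact isClosed_iInter fun s => isClosed_iInter fun t =>
          isClosed_le ((h1 s).dist (h1 t)) continuous_const
      · simp only [Set.ofPred_forall]
        exact isClosed_iInter fun t => Metric.isClosed_closedBall.preimage (h1 t)
    · refine (LipschitzWith.uniformEquicontinuous (fun f : A => (f : Set.Icc (0 : ℝ) 1 → E)) M
        fun f => LipschitzWith.of_dist_le_mul f.2.1).equicontinuous
  have hψA : ∀ k, ψ k ∈ A := by
    intro k
    refine ⟨fun s t => (hφL k).dist_le_mul s t, fun t => ?_⟩
    rw [Metric.mem_closedBall]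
    have h1 := (hφL k).dist_le_mul t 0
    rw [hφ0] at h1
    refine h1.trans ?_
    have : dist (t : ℝ) 0 ≤ 1 := by
      rw [Real.dist_eq, sub_zero, abs_of_nonneg t.2.1]; exact t.2.2
    exact mul_le_of_le_one_right M.2 this
  obtain ⟨f, -, κ, hκ, hlim⟩ := hA.tendsto_subseq hψA
  have hf : ∀ t : Set.Icc (0 : ℝ) 1, Tendsto (fun k => φ (κ k) t) atTop (𝓝 (f t)) := fun t =>
    (((BoundedContinuousFunction.lipschitz_eval_const t).continuous).tendsto f).comp hlim
  let G : ℝ → E := Set.IccExtend zero_le_one f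
  have hGc : Continuous G := f.continuous.Icc_extend'
  have hG : ∀ t ∈ Set.Icc (0 : ℝ) 1, Tendsto (fun k => φ (κ k) t) atTop (𝓝 (G t)) := by
    intro t ht
    have : G t = f ⟨t, ht⟩ := Set.IccExtend_of_mem _ _ ht
    rw [this]
    exact hf ⟨t, ht⟩
  have hIc : Continuous fun s => F s (G s) := hF.comp (continuous_id.prodMk hGc)
  have heq : ∀ t ∈ Set.Icc (0 : ℝ) 1, G t = x₀ + ∫ s in (0 : ℝ)..t, F s (G s) := by
    intro t ht
    refine tendsto_nhds_unique (hG t ht) ?_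
    simp only [fun k => hφ (κ k) t ht]
    refine tendsto_const_nhds.add ?_
    refine intervalIntegral.tendsto_integral_filter_of_dominated_convergence (fun _ => (M : ℝ))
      (Eventually.of_forall fun k => ?_)
      (Eventually.of_forall fun k => Eventually.of_forall fun s _ => hM _ _)
      intervalIntegrable_const (Eventually.of_forall fun s hs => ?_)
    · exact (hF.comp (continuous_id.prodMk ((hφL _).continuous.comp
        (by fun_prop)))).aestronglyMeasurable
    · rw [Set.uIoc_of_le ht.1] at hs
      have hs' : s ∈ Set.Icc (0 : ℝ) 1 := ⟨hs.1.le, hs.2.trans ht.2⟩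
      have h1 : Tendsto (fun k => φ (κ k) (s - 1 / ((κ k : ℝ) + 1))) atTop (𝓝 (G s)) := by
        refine tendsto_of_tendsto_of_dist (hG s hs') ?_
        refine squeeze_zero (fun _ => dist_nonneg)
          (fun k => (hφL (κ k)).dist_le_mul _ _) ?_
        have h2 : Tendsto (fun k => (M : ℝ) * (1 / ((κ k : ℝ) + 1))) atTop (𝓝 (M * 0)) :=
          (tendsto_one_div_add_atTop_nhds_zero_nat.comp hκ.tendsto_atTop).const_mul _
        rw [mul_zero] at h2
        refine h2.congr fun k => ?_
        rw [Real.dist_eq, sub_sub_cancel, abs_of_pos (by positivity)]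
      exact (hF.tendsto (s, G s)).comp (tendsto_const_nhds.prodMk_nhds h1)
  refine ⟨fun t => x₀ + ∫ s in (0 : ℝ)..t, F s (G s), by simp, fun t ht => ?_⟩
  dsimp only
  rw [← heq t ht]
  exact (intervalIntegral.integral_hasDerivAt_right (hIc.intervalIntegrable _ _)
    (hIc.stronglyMeasurableAtFilter _ _) hIc.continuousAt).const_add x₀

/-- Peano's theorem. -/
theorem exists_local_solution [ProperSpace E] (hF : Continuous (Function.uncurry F)) (x₀ : E) :
    ∃ δ : ℝ, 0 < δ ∧ ∃ x : ℝ → E, x 0 = x₀ ∧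
      ∀ t ∈ Set.Icc (0 : ℝ) δ, HasDerivAt x (F t (x t)) t := by
  -- The cutoff is 1 on the unit ball about x₀ and 0 outside radius 2. With time clamped to [0, 1],
  -- the field becomes globally bounded and is unchanged near the initial point.
  let χ : E → ℝ := fun x => max 0 (min 1 (2 - dist x x₀))
  let cl : ℝ → ℝ := fun t => max 0 (min 1 t)
  let G : ℝ → E → E := fun t x => χ x • F (cl t) x
  have hG : Continuous (Function.uncurry G) := by
    have h1 : Continuous fun p : ℝ × E => F (cl p.1) p.2 :=
      hF.comp (Continuous.prodMk (by fun_prop) continuous_snd)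
    have h2 : Continuous fun p : ℝ × E => χ p.2 := by fun_prop
    exact h2.smul h1
  obtain ⟨M, hM⟩ := ((isCompact_Icc (a := (0 : ℝ)) (b := 1)).prod
    (isCompact_closedBall x₀ 2)).exists_bound_of_continuousOn hF.continuousOn
  have hM' : ∀ t x, ‖G t x‖ ≤ (M.toNNReal : ℝ) := by
    intro t x
    have hχ0 : 0 ≤ χ x := le_max_left _ _
    have hχ1 : χ x ≤ 1 := max_le zero_le_one (min_le_left _ _)
    by_cases hx : dist x x₀ ≤ 2
    · have hcl : cl t ∈ Set.Icc (0 : ℝ) 1 :=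
        ⟨le_max_left _ _, max_le zero_le_one (min_le_left _ _)⟩
      have h := hM (cl t, x) ⟨hcl, hx⟩
      simp only [Function.uncurry] at h
      rw [norm_smul, Real.norm_of_nonneg hχ0]
      exact ((mul_le_of_le_one_left (norm_nonneg _) hχ1).trans h).trans (Real.le_coe_toNNReal M)
    · have : χ x = 0 := max_eq_left ((min_le_right _ _).trans (by linarith))
      simp [G, this]
  obtain ⟨x, hx0, hx⟩ := exists_solution_of_bounded hG hM' x₀
  have hev : ∀ᶠ t in 𝓝 (0 : ℝ), dist (x t) x₀ < 1 := by
    have := (hx 0 (by simp)).continuousAt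
    have h := Metric.tendsto_nhds.1 this 1 one_pos
    simpa [hx0] using h
  obtain ⟨δ, hδ, hball⟩ := Metric.eventually_nhds_iff.1 hev
  refine ⟨min (δ / 2) 1, by positivity, x, hx0, fun t ht => ?_⟩
  have ht1 : t ≤ 1 := ht.2.trans (min_le_right _ _)
  have ht2 : t ≤ δ / 2 := ht.2.trans (min_le_left _ _)
  have h := hx t ⟨ht.1, ht1⟩
  have hd : dist (x t) x₀ < 1 := hball (by
    rw [Real.dist_eq, sub_zero, abs_of_nonneg ht.1]; linarith)
  have hχ : χ (x t) = 1 := by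
    simp only [χ]
    rw [min_eq_left (by linarith), max_eq_right zero_le_one]
  have hcl : cl t = t := by
    simp only [cl]
    rw [min_eq_right ht1, max_eq_right ht.1]
  simpa [G, hχ, hcl] using h

end Peano

end ExtremumSeeking

namespace ExtremumSeeking

/-! ### Continuation of bounded solutions. -/

section Extension

open Filter Topology

theorem timeDomain_coe (T : ℝ) : timeDomain (T : EReal) = Set.Ico 0 T := by
  ext t
  simp [timeDomain]

theorem ordConnected_timeDomain (T : EReal) : (timeDomain T).OrdConnected := by
  refine ⟨fun a ha b hb c hc => ⟨ha.1.trans hc.1, lt_of_le_of_lt ?_ hb.2⟩⟩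
  exact_mod_cast hc.2

variable {E : Type*} [NormedAddCommGroup E] [NormedSpace ℝ E]
  {f : ℝ → E → ℝ → E} {ε : ℝ} {x₀ : E} {τ₀ : ℝ} {T : EReal} {x : ℝ → E} {τ : ℝ → ℝ}

theorem IsSolution.zero_mem (h : IsSolution f ε x₀ τ₀ T x τ) : (0 : ℝ) ∈ timeDomain T :=
  ⟨le_rfl, by exact_mod_cast h.pos⟩

theorem IsSolution.τ_eq (h : IsSolution f ε x₀ τ₀ T x τ) {t : ℝ} (ht : t ∈ timeDomain T) :
    τ t = τ₀ + (ε ^ 2)⁻¹ * t := by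
  have hd : ∀ s ∈ timeDomain T,
      HasDerivWithinAt (fun s => τ s - (ε ^ 2)⁻¹ * s) 0 (timeDomain T) s := by
    intro s hs
    have := (h.deriv_τ s hs).sub ((hasDerivWithinAt_id s _).const_mul ((ε ^ 2)⁻¹))
    rwa [mul_one, sub_self] at this
  have := (ordConnected_timeDomain T).convex.norm_image_sub_le_of_norm_hasDerivWithin_le
    (C := 0) hd (by simp) h.zero_mem ht
  rw [zero_mul] at this
  have h0 := sub_eq_zero.1 (norm_le_zero_iff.1 this)
  rw [h.init_τ] at h0
  linarith

/-- A bounded maximal solution is complete. -/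
theorem IsMaximalSolution.eq_top_of_bounded [FiniteDimensional ℝ E]
    (hf : Continuous (Function.uncurry (f ε)))
    (h : IsMaximalSolution f ε x₀ τ₀ T x τ) {R : ℝ} (hR : ∀ t ∈ timeDomain T, ‖x t‖ ≤ R) :
    T = ⊤ := by
  by_contra hT
  obtain ⟨hsol, hmax⟩ := h
  have hbot : T ≠ ⊥ := fun hb => by
    have := hsol.pos
    rw [hb] at this
    exact not_lt_bot this
  lift T to ℝ using ⟨hT, hbot⟩
  have hTpos : 0 < T := by exact_mod_cast hsol.pos
  have : ProperSpace E := FiniteDimensional.proper_real E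
  set e : ℝ := (ε ^ 2)⁻¹
  have hτ : ∀ t ∈ Set.Ico 0 T, τ t = τ₀ + e * t := fun t ht =>
    hsol.τ_eq (by rwa [timeDomain_coe])
  have hdx := hsol.deriv_x
  rw [timeDomain_coe] at hdx hR
  let F : ℝ → E → E := fun s y => f ε y (τ₀ + e * (T + s))
  have hF : Continuous (Function.uncurry F) := by
    have : Continuous fun p : ℝ × E => (p.2, τ₀ + e * (T + p.1)) := by fun_prop
    exact hf.comp this
  obtain ⟨M, hM⟩ := ((isCompact_closedBall (0 : E) R).prod
    (isCompact_Icc (a := -T) (b := 0))).exists_bound_of_continuousOn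
      (f := fun p : E × ℝ => F p.2 p.1) (hF.comp continuous_swap).continuousOn
  have hF' : ∀ t ∈ Set.Ico 0 T, f ε (x t) (τ t) = F (t - T) (x t) := by
    intro t ht
    simp only [F, hτ t ht]
    congr 3
    ring
  have hlip : LipschitzOnWith M.toNNReal x (Set.Ico 0 T) := by
    refine (convex_Ico 0 T).lipschitzOnWith_of_nnnorm_hasDerivWithin_le hdx fun t ht => ?_
    rw [← NNReal.coe_le_coe, coe_nnnorm, hF' t ht]
    refine (hM (x t, t - T) ⟨?_, ?_⟩).trans (Real.le_coe_toNNReal M)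
    · simpa using hR t ht
    · exact ⟨by linarith [ht.1], by linarith [ht.2]⟩
  -- The Lipschitz extension supplies the limit g T, from which Peano's theorem restarts the
  -- solution.
  obtain ⟨g, hg, hgx⟩ := hlip.extend_finite_dimension
  obtain ⟨δ, hδ, ξ, hξ0, hξ⟩ := exists_local_solution hF (g T)
  let X : ℝ → E := fun t => if t < T then g t else ξ (t - T)
  have hXg : Set.EqOn X g (Set.Iic T) := by
    intro t ht
    rcases lt_or_eq_of_le (Set.mem_Iic.1 ht) with h | h
    · simp [X, h]
    · simp [X, h, hξ0]
  have hXξ : Set.EqOn X (fun t => ξ (t - T)) (Set.Ici T) := by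
    intro t ht
    simp [X, not_lt.2 (Set.mem_Ici.1 ht)]
  have hXx : Set.EqOn X x (Set.Ico 0 T) := fun t ht => (hXg ht.2.le).trans (hgx ht).symm
  let θ : ℝ → ℝ := fun t => τ₀ + e * t
  have hleft : ∀ t ∈ Set.Ico 0 T,
      HasDerivWithinAt X (f ε (X t) (θ t)) (Set.Ico 0 T) t := by
    intro t ht
    have := (hdx t ht).congr hXx (hXx ht)
    rwa [hτ t ht, ← hXx ht] at this
  have hright : ∀ t ∈ Set.Ico T (T + δ),
      HasDerivWithinAt X (f ε (X t) (θ t)) (Set.Ici T) t := by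
    intro t ht
    have h1 : HasDerivAt (fun t => ξ (t - T)) (F (t - T) (ξ (t - T))) t :=
      (hξ (t - T) ⟨by linarith [ht.1], by linarith [ht.2]⟩).comp_sub_const t T
    have := h1.hasDerivWithinAt.congr hXξ (hXξ ht.1)
    have hx : ξ (t - T) = X t := (hXξ ht.1).symm
    simpa only [F, hx, add_sub_cancel] using this
  have hderiv : ∀ t ∈ Set.Ico 0 (T + δ),
      HasDerivWithinAt X (f ε (X t) (θ t)) (Set.Ico 0 (T + δ)) t := by
    intro t ht
    rcases lt_trichotomy t T with htT | rfl | htT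
    · refine (hleft t ⟨ht.1, htT⟩).mono_of_mem_nhdsWithin ?_
      filter_upwards [self_mem_nhdsWithin, mem_nhdsWithin_of_mem_nhds (Iio_mem_nhds htT)]
        with s hs hs' using ⟨hs.1, hs'⟩
    -- At the junction the left derivative is the limit of the derivatives from the left; it equals
    -- the right derivative because the field is continuous.
    · have hnhd : Set.Ioo 0 t ∈ 𝓝[<] t := Ioo_mem_nhdsLT hTpos
      have hat : ∀ s ∈ Set.Ioo 0 t, HasDerivAt X (f ε (X s) (θ s)) s := fun s hs =>
        (hleft s ⟨hs.1.le, hs.2⟩).hasDerivAt (Ico_mem_nhds hs.1 hs.2)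
      have hcont : ContinuousWithinAt X (Set.Iic t) t :=
        (hg.continuous.continuousWithinAt).congr hXg (hXg Set.self_mem_Iic)
      have hl : HasDerivWithinAt X (f ε (X t) (θ t)) (Set.Iic t) t := by
        refine hasDerivWithinAt_Iic_of_tendsto_deriv (s := Set.Ioo 0 t)
          (fun s hs => (hat s hs).differentiableAt.differentiableWithinAt)
          (hcont.mono fun s hs => hs.2.le) hnhd ?_
        have h1 : Tendsto (fun s => f ε (X s) (θ s)) (𝓝[<] t) (𝓝 (f ε (X t) (θ t))) := by
          have h2 : Tendsto (fun s => (X s, θ s)) (𝓝[<] t) (𝓝 (X t, θ t)) :=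
            (hcont.mono Set.Iio_subset_Iic_self).prodMk_nhds
              ((by fun_prop : Continuous θ).continuousWithinAt)
          exact (hf.tendsto _).comp h2
        refine h1.congr' ?_
        filter_upwards [hnhd] with s hs using (hat s hs).deriv.symm
      have hr := hright t ⟨le_rfl, by linarith⟩
      have := hl.union hr
      rw [Set.Iic_union_Ici] at this
      exact this.mono (Set.subset_univ _)
    · exact ((hright t ⟨htT.le, ht.2⟩).hasDerivAt (Ici_mem_nhds htT)).hasDerivWithinAt
  have hnew : IsSolution f ε x₀ τ₀ ((T + δ : ℝ) : EReal) X θ := by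
    refine ⟨by exact_mod_cast (by linarith : 0 < T + δ), ?_, by simp [θ], ?_, ?_⟩
    · rw [hXx ⟨le_rfl, hTpos⟩, hsol.init_x]
    · rw [timeDomain_coe]
      exact hderiv
    · intro t _
      have := ((hasDerivWithinAt_id t (timeDomain ((T + δ : ℝ) : EReal))).const_mul e).const_add τ₀
      rwa [mul_one] at this
  have := hmax _ X θ hnew fun t ht => by
    rw [timeDomain_coe] at ht
    exact ⟨hXx ht, (hτ t ht).symm⟩
  have : T + δ ≤ T := by exact_mod_cast this
  linarith

end Extension

/-! ### Class KL functions from implicit inequalities. -/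

section ClassKL

open Filter Topology Set

/-- The inverse in the first argument of a function `G s t` that is increasing and unbounded in
both arguments is of class `KL`. -/
theorem exists_classKL_of_inverse {G : ℝ → ℝ → ℝ}
    (hc : ContinuousOn (fun p : ℝ × ℝ => G p.1 p.2) (Ici 0 ×ˢ Ici 0))
    (hmono : ∀ t, 0 ≤ t → StrictMonoOn (fun s => G s t) (Ici 0)) (h0 : ∀ t, 0 ≤ t → G 0 t = 0)
    (htop : ∀ t, 0 ≤ t → Tendsto (fun s => G s t) atTop atTop)
    (hmono' : ∀ s, 0 < s → StrictMonoOn (G s) (Ici 0))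
    (htop' : ∀ s, 0 < s → Tendsto (G s) atTop atTop) :
    ∃ β : ℝ → ℝ → ℝ, IsClassKL β ∧
      ∀ r t s, 0 ≤ r → 0 ≤ t → 0 ≤ s → G s t ≤ r → s ≤ β r t := by
  have hc1 : ∀ t, 0 ≤ t → ContinuousOn (fun s => G s t) (Ici 0) := fun t ht =>
    hc.comp (f := fun s => (s, t)) (by fun_prop) fun s hs => ⟨hs, ht⟩
  have hc2 : ∀ s, 0 ≤ s → ContinuousOn (G s) (Ici 0) := fun s hs =>
    hc.comp (f := fun t => (s, t)) (by fun_prop) fun t ht => ⟨hs, ht⟩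
  have hex : ∀ r t, 0 ≤ r → 0 ≤ t → ∃ s, 0 ≤ s ∧ G s t = r := by
    intro r t hr ht
    obtain ⟨B, hB, hB0⟩ := ((htop t ht).eventually_ge_atTop r |>.and (eventually_ge_atTop 0)).exists
    have := intermediate_value_Icc hB0 ((hc1 t ht).mono Icc_subset_Ici_self)
    obtain ⟨s, hs, hs'⟩ := this ⟨by simpa [h0 t ht] using hr, hB⟩
    exact ⟨s, hs.1, hs'⟩
  choose! β hβ0 hβ using hex
  -- This equivalence and the next turn each order or limit statement about β, including joint
  -- continuity, into one about G.
  have hle : ∀ {r t s}, 0 ≤ r → 0 ≤ t → 0 ≤ s → (s ≤ β r t ↔ G s t ≤ r) := fun {r t s} hr ht hs => by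
    have := (hmono t ht).le_iff_le (a := s) (b := β r t) hs (hβ0 r t hr ht)
    simp only [hβ r t hr ht] at this
    exact this.symm
  have hge : ∀ {r t s}, 0 ≤ r → 0 ≤ t → 0 ≤ s → (β r t ≤ s ↔ r ≤ G s t) := fun {r t s} hr ht hs => by
    have := (hmono t ht).le_iff_le (a := β r t) (b := s) (hβ0 r t hr ht) hs
    simp only [hβ r t hr ht] at this
    exact this.symm
  have hcont : ContinuousOn (fun p : ℝ × ℝ => β p.1 p.2) (Ici 0 ×ˢ Ici 0) := by
    rintro ⟨r, t⟩ ⟨hr, ht⟩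
    rw [mem_Ici] at hr ht
    have hG : ∀ a, 0 ≤ a → Tendsto (fun p : ℝ × ℝ => G a p.2) (𝓝[Ici 0 ×ˢ Ici 0] (r, t))
        (𝓝 (G a t)) := fun a ha => by
      have : ContinuousOn (fun p : ℝ × ℝ => G a p.2) (Ici 0 ×ˢ Ici 0) :=
        (hc2 a ha).comp continuousOn_snd fun p hp => hp.2
      exact this (r, t) ⟨hr, ht⟩
    have hfst : Tendsto (fun p : ℝ × ℝ => p.1) (𝓝[Ici 0 ×ˢ Ici 0] (r, t)) (𝓝 r) :=
      (continuous_fst.tendsto (r, t)).mono_left nhdsWithin_le_nhds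
    refine tendsto_order.2 ⟨fun a ha => ?_, fun a ha => ?_⟩
    · rcases lt_or_ge a 0 with h | h
      · filter_upwards [self_mem_nhdsWithin] with p hp using h.trans_le (hβ0 _ _ hp.1 hp.2)
      · have h1 : G a t < r := not_le.1 fun h2 => ha.not_ge ((hge hr ht h).2 h2)
        filter_upwards [self_mem_nhdsWithin, (hG a h).eventually_lt hfst h1] with p hp hp'
        exact not_le.1 fun h2 => hp'.not_ge ((hge hp.1 hp.2 h).1 h2)
    · have h : 0 ≤ a := (hβ0 r t hr ht).trans ha.le
      have h1 : r < G a t := not_le.1 fun h2 => ha.not_ge ((hle hr ht h).2 h2)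
      filter_upwards [self_mem_nhdsWithin, hfst.eventually_lt (hG a h) h1] with p hp hp'
      exact not_le.1 fun h2 => hp'.not_ge ((hle hp.1 hp.2 h).1 h2)
  refine ⟨β, ⟨hcont, fun t ht => ⟨⟨?_, ?_, ?_⟩, ?_⟩, ?_, ?_⟩, fun r t s hr ht hs h =>
    (hle hr ht hs).2 h⟩
  · exact hcont.comp (f := fun r => (r, t)) (by fun_prop) fun r hr => ⟨hr, ht⟩
  · intro r hr r' hr' hlt
    refine not_le.1 fun h => hlt.not_ge ?_
    have := (hge hr' ht (hβ0 r t hr ht)).1 h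
    rwa [hβ r t hr ht] at this
  · exact le_antisymm ((hge le_rfl ht le_rfl).2 (h0 t ht).ge) (hβ0 _ _ le_rfl ht)
  · refine tendsto_atTop.2 fun B => ?_
    filter_upwards [eventually_ge_atTop (G (max B 0) t), eventually_ge_atTop 0] with r hr hr0
    exact (le_max_left B 0).trans ((hle hr0 ht (le_max_right B 0)).2 hr)
  · intro r hr t ht t' ht' hlt
    rw [mem_Ici] at ht ht'
    have hpos : 0 < β r t' := by
      refine lt_of_le_of_ne (hβ0 _ _ hr.le ht') fun h => ?_
      have := hβ r t' hr.le ht'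
      rw [← h, h0 t' ht'] at this
      exact hr.ne this
    refine not_le.1 fun h => ?_
    have h1 := (hge hr.le ht hpos.le).1 h
    have h2 := hmono' _ hpos ht ht' hlt
    rw [hβ r t' hr.le ht'] at h2
    exact h2.not_ge h1
  · intro r hr
    refine tendsto_order.2 ⟨fun a ha => ?_, fun a ha => ?_⟩
    · filter_upwards [eventually_ge_atTop 0] with t ht using ha.trans_le (hβ0 r t hr ht)
    · filter_upwards [eventually_ge_atTop 0, (htop' a ha).eventually_gt_atTop r] with t ht h
      exact not_le.1 fun h2 => h.not_ge ((hle hr ht ha.le).1 h2)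

/-- The class `KL` bound attached to a decay rate `κ s` of the size measure `h s`. -/
theorem exists_classKL_of_rate {h κ : ℝ → ℝ} (hh : IsClassKInf h)
    (hκc : ContinuousOn κ (Ici 0)) (hκm : MonotoneOn κ (Ici 0)) (hκ0 : 0 ≤ κ 0)
    (hκp : ∀ s, 0 < s → 0 < κ s)
    {L : ℝ} (hL : 0 < L) :
    ∃ β : ℝ → ℝ → ℝ, IsClassKL β ∧
      ∀ r t s, 0 ≤ r → 0 ≤ t → 0 ≤ s → h s * Real.exp (κ s * t) ≤ L * r ^ 2 → s ≤ β r t := by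
  have hn : ∀ s, 0 ≤ s → 0 ≤ h s := fun s hs => by
    have := hh.strictMonoOn.monotoneOn (self_mem_Ici) hs hs
    rwa [hh.map_zero] at this
  have hp : ∀ s, 0 < s → 0 < h s := fun s hs => by
    have := hh.strictMonoOn (self_mem_Ici) hs.le hs
    rwa [hh.map_zero] at this
  have hκn : ∀ s, 0 ≤ s → 0 ≤ κ s := fun s hs => hκ0.trans (hκm self_mem_Ici hs hs)
  -- Dividing by L and taking the square root isolates r, the form that can be inverted.
  suffices hG : ∃ β : ℝ → ℝ → ℝ, IsClassKL β ∧ ∀ r t s, 0 ≤ r → 0 ≤ t → 0 ≤ s →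
      √(h s * Real.exp (κ s * t) / L) ≤ r → s ≤ β r t by
    obtain ⟨β, hβ, hβ'⟩ := hG
    refine ⟨β, hβ, fun r t s hr ht hs hle => hβ' r t s hr ht hs ?_⟩
    rw [Real.sqrt_le_left hr, div_le_iff₀ hL, mul_comm _ L]
    exact hle
  refine exists_classKL_of_inverse ?_ ?_ ?_ ?_ ?_ ?_
  · have h1 : ContinuousOn (fun p : ℝ × ℝ => h p.1) (Ici 0 ×ˢ Ici 0) :=
      hh.continuousOn.comp continuousOn_fst fun p hp => hp.1
    have h2 : ContinuousOn (fun p : ℝ × ℝ => κ p.1) (Ici 0 ×ˢ Ici 0) :=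
      hκc.comp continuousOn_fst fun p hp => hp.1
    exact Real.continuous_sqrt.comp_continuousOn
      ((h1.mul (Real.continuous_exp.comp_continuousOn (h2.mul continuousOn_snd))).div_const L)
  · intro t ht s hs s' hs' hlt
    have hs0 : (0 : ℝ) ≤ s := hs
    have : κ s ≤ κ s' := hκm hs hs' hlt.le
    have h2 := hh.strictMonoOn hs hs' hlt
    refine Real.sqrt_lt_sqrt (by have := hn s hs; positivity) ?_
    refine div_lt_div_of_pos_right ?_ hL
    exact mul_lt_mul h2 (Real.exp_le_exp.2 (by gcongr)) (Real.exp_pos _) (hn s' hs')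
  · intro t _
    simp [hh.map_zero]
  · intro t ht
    refine Real.tendsto_sqrt_atTop.comp ((tendsto_atTop_mono' _ ?_
      (hh.tendsto_atTop)).atTop_div_const hL)
    filter_upwards [eventually_ge_atTop 0] with s hs
    exact le_mul_of_one_le_right (hn s hs) (Real.one_le_exp (mul_nonneg (hκn s hs) ht))
  · intro s hs t ht t' ht' hlt
    have := hp s hs
    have := hκp s hs
    refine Real.sqrt_lt_sqrt (by positivity) ?_
    gcongr
  · intro s hs
    exact Real.tendsto_sqrt_atTop.comp (((Real.tendsto_exp_atTop.comp
      (tendsto_id.const_mul_atTop (hκp s hs))).const_mul_atTop (hp s hs)).atTop_div_const hL)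

end ClassKL

end ExtremumSeeking

namespace ExtremumSeeking

/-! ### Estimates for a cost with bounded Hessian. -/

section Cost

open scoped InnerProductSpace

variable {E : Type*} [NormedAddCommGroup E] [InnerProductSpace ℝ E] [CompleteSpace E]
  {J : E → ℝ} {L : ℝ}

theorem hasFDerivAt_gradient (hJ : ContDiff ℝ 2 J) (x : E) :
    HasFDerivAt J (innerSL ℝ (gradient J x)) x := by
  have h := (hJ.differentiable (by norm_num) x).hasGradientAt.hasFDerivAt
  exact h

theorem differentiable_gradient (hJ : ContDiff ℝ 2 J) : Differentiable ℝ (gradient J) := by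
  have h : Differentiable ℝ (fderiv ℝ J) :=
    (hJ.fderiv_right (m := 1) (by norm_num)).differentiable (by norm_num)
  exact (InnerProductSpace.toDual ℝ E).symm.toContinuousLinearEquiv.differentiable.comp h

theorem norm_gradient_sub_le (hJ : ContDiff ℝ 2 J)
    (hL : ∀ x, ‖fderiv ℝ (gradient J) x‖ ≤ L) (x y : E) :
    ‖gradient J y - gradient J x‖ ≤ L * ‖y - x‖ :=
  convex_univ.norm_image_sub_le_of_norm_fderiv_le
    (fun z _ => differentiable_gradient hJ z) (fun z _ => hL z) (Set.mem_univ x) (Set.mem_univ y)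

/-- On the ball of radius ‖y - x‖ the gradient varies by at most L‖y - x‖, and the mean value
inequality is applied there. This gives the constant L instead of the sharp L/2. -/
theorem abs_taylor_le (hJ : ContDiff ℝ 2 J)
    (hL : ∀ x, ‖fderiv ℝ (gradient J) x‖ ≤ L) (x y : E) :
    |J y - J x - ⟪gradient J x, y - x⟫_ℝ| ≤ L * ‖y - x‖ ^ 2 := by
  have hL0 : 0 ≤ L := (norm_nonneg _).trans (hL x)
  have h := (convex_closedBall x ‖y - x‖).norm_image_sub_le_of_norm_hasFDerivWithin_le'
    (f := J) (f' := fun z => innerSL ℝ (gradient J z)) (φ := innerSL ℝ (gradient J x))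
    (C := L * ‖y - x‖) (x := x) (y := y)
    (fun z _ => (hasFDerivAt_gradient hJ z).hasFDerivWithinAt) (fun z hz => ?_)
    (Metric.mem_closedBall_self (norm_nonneg _)) (by simp [dist_eq_norm])
  · rw [pow_two, ← mul_assoc]
    simpa using h
  · rw [← map_sub, innerSL_apply_norm]
    refine (norm_gradient_sub_le hJ hL x z).trans ?_
    rw [Metric.mem_closedBall, dist_eq_norm] at hz
    gcongr

theorem sub_min_le {xs : E} (hJ : ContDiff ℝ 2 J) (hL : ∀ x, ‖fderiv ℝ (gradient J) x‖ ≤ L)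
    (h0 : gradient J xs = 0) (x : E) : J x - J xs ≤ L * ‖x - xs‖ ^ 2 := by
  have h := abs_taylor_le hJ hL xs x
  rw [h0, inner_zero_left, sub_zero] at h
  exact (le_abs_self _).trans h

/-- A gradient step of size 1/(2L) lowers J by at least ‖g‖²/(4L), yet J cannot fall below its
minimum. -/
theorem norm_gradient_sq_le {xs : E} (hJ : ContDiff ℝ 2 J)
    (hL : ∀ x, ‖fderiv ℝ (gradient J) x‖ ≤ L) (hLpos : 0 < L) (hmin : ∀ x, J xs ≤ J x) (x : E) :
    ‖gradient J x‖ ^ 2 ≤ 4 * L * (J x - J xs) := by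
  set g := gradient J x with hg
  have h := (le_abs_self _).trans (abs_taylor_le hJ hL x (x - (2 * L)⁻¹ • g))
  have h1 := hmin (x - (2 * L)⁻¹ • g)
  rw [sub_sub_cancel_left, ← hg, inner_neg_right, real_inner_smul_right,
    real_inner_self_eq_norm_sq, norm_neg, norm_smul, Real.norm_of_nonneg (by positivity)] at h
  have h2 : (2 * L)⁻¹ * ‖g‖ ^ 2 - L * ((2 * L)⁻¹ * ‖g‖) ^ 2 ≤ J x - J xs := by linarith
  have h3 : (2 * L)⁻¹ * ‖g‖ ^ 2 - L * ((2 * L)⁻¹ * ‖g‖) ^ 2 = ‖g‖ ^ 2 / (4 * L) := by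
    field_simp
    ring
  rw [h3, div_le_iff₀ (by positivity)] at h2
  linarith

end Cost

/-! ### Algebra of averaging: quadratic correctors. -/

section Corrector

variable {ι : Type*}

/-- `q` is a quadratic expression whose leading derivative is `e * p`, whenever `S`, `C` rotate
with frequencies `e * w i` up to a remainder. -/
def IsCorrector (w : ι → ℝ) (q p : (ι → ℝ) → (ι → ℝ) → ℝ) : Prop :=
  ∃ K : ℝ, 0 ≤ K ∧
    (∀ (S C : ι → ℝ) (B : ℝ), (∀ i, |S i| ≤ B) → (∀ i, |C i| ≤ B) → |q S C| ≤ K * B ^ 2) ∧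
    ∀ (D : Set ℝ) (t : ℝ) (S C : ℝ → ι → ℝ) (e : ℝ) (RS RC : ι → ℝ) (B R : ℝ),
      (∀ i, |S t i| ≤ B) → (∀ i, |C t i| ≤ B) → (∀ i, |RS i| ≤ R) → (∀ i, |RC i| ≤ R) →
      (∀ i, HasDerivWithinAt (fun s => S s i) (-(w i * e * C t i) + RS i) D t) →
      (∀ i, HasDerivWithinAt (fun s => C s i) (w i * e * S t i + RC i) D t) →
      ∃ d, HasDerivWithinAt (fun s => q (S s) (C s)) d D t ∧
        |d - e * p (S t) (C t)| ≤ K * (B * R)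

variable {w : ι → ℝ}

theorem abs_mul_le_of_abs_le {a b A B : ℝ} (ha : |a| ≤ A) (hb : |b| ≤ B) : |a * b| ≤ A * B := by
  rw [abs_mul]
  exact mul_le_mul ha hb (abs_nonneg _) ((abs_nonneg _).trans ha)

theorem abs_leibniz_remainder_le {f h r r' B R : ℝ} (hf : |f| ≤ B) (hh : |h| ≤ B) (hr : |r| ≤ R)
    (hr' : |r'| ≤ R) : |r * h + f * r'| ≤ 2 * (B * R) := by
  have h1 := abs_mul_le_of_abs_le hr hh
  have h2 := abs_mul_le_of_abs_le hf hr'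
  refine (abs_add_le _ _).trans ?_
  linarith

theorem abs_mul_le_two_mul_sq {f h B : ℝ} (hf : |f| ≤ B) (hh : |h| ≤ B) :
    |f * h| ≤ 2 * B ^ 2 := by
  have := abs_mul_le_of_abs_le hf hh
  nlinarith [sq_nonneg B]

theorem IsCorrector.mul_SS (i k : ι) : IsCorrector w (fun S _ => S i * S k)
    (fun S C => -(w i * C i * S k) - w k * S i * C k) := by
  refine ⟨2, by norm_num, fun S C B hS _ => abs_mul_le_two_mul_sq (hS i) (hS k), ?_⟩
  intro D t S C e RS RC B R hS hC hRS hRC hdS hdC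
  refine ⟨_, (hdS i).mul (hdS k), ?_⟩
  convert abs_leibniz_remainder_le (hS i) (hS k) (hRS i) (hRS k) using 2
  ring

theorem IsCorrector.mul_SC (i k : ι) : IsCorrector w (fun S C => S i * C k)
    (fun S C => -(w i * C i * C k) + w k * S i * S k) := by
  refine ⟨2, by norm_num, fun S C B hS hC => abs_mul_le_two_mul_sq (hS i) (hC k), ?_⟩
  intro D t S C e RS RC B R hS hC hRS hRC hdS hdC
  refine ⟨_, (hdS i).mul (hdC k), ?_⟩
  convert abs_leibniz_remainder_le (hS i) (hC k) (hRS i) (hRC k) using 2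
  ring

theorem IsCorrector.mul_CC (i k : ι) : IsCorrector w (fun _ C => C i * C k)
    (fun S C => w i * S i * C k + w k * C i * S k) := by
  refine ⟨2, by norm_num, fun S C B hS hC => abs_mul_le_two_mul_sq (hC i) (hC k), ?_⟩
  intro D t S C e RS RC B R hS hC hRS hRC hdS hdC
  refine ⟨_, (hdC i).mul (hdC k), ?_⟩
  convert abs_leibniz_remainder_le (hC i) (hC k) (hRC i) (hRC k) using 2
  ring

theorem IsCorrector.add {q p q' p' : (ι → ℝ) → (ι → ℝ) → ℝ} (h : IsCorrector w q p)
    (h' : IsCorrector w q' p') :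
    IsCorrector w (fun S C => q S C + q' S C) (fun S C => p S C + p' S C) := by
  obtain ⟨K, hK, hq, hd⟩ := h
  obtain ⟨K', hK', hq', hd'⟩ := h'
  refine ⟨K + K', by positivity, fun S C B hS hC => ?_, ?_⟩
  · refine (abs_add_le _ _).trans ?_
    linarith [hq S C B hS hC, hq' S C B hS hC]
  · intro D t S C e RS RC B R hS hC hRS hRC hdS hdC
    obtain ⟨d, h1, h2⟩ := hd D t S C e RS RC B R hS hC hRS hRC hdS hdC
    obtain ⟨d', h1', h2'⟩ := hd' D t S C e RS RC B R hS hC hRS hRC hdS hdC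
    refine ⟨d + d', h1.add h1', ?_⟩
    rw [show d + d' - e * (p (S t) (C t) + p' (S t) (C t)) =
      (d - e * p (S t) (C t)) + (d' - e * p' (S t) (C t)) by ring]
    refine (abs_add_le _ _).trans ?_
    linarith

theorem IsCorrector.const_mul {q p : (ι → ℝ) → (ι → ℝ) → ℝ} (h : IsCorrector w q p) (a : ℝ) :
    IsCorrector w (fun S C => a * q S C) (fun S C => a * p S C) := by
  obtain ⟨K, hK, hq, hd⟩ := h
  refine ⟨|a| * K, by positivity, fun S C B hS hC => ?_, ?_⟩
  · rw [abs_mul, mul_assoc]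
    gcongr
    exact hq S C B hS hC
  · intro D t S C e RS RC B R hS hC hRS hRC hdS hdC
    obtain ⟨d, h1, h2⟩ := hd D t S C e RS RC B R hS hC hRS hRC hdS hdC
    refine ⟨a * d, h1.const_mul a, ?_⟩
    rw [show a * d - e * (a * p (S t) (C t)) = a * (d - e * p (S t) (C t)) by ring, abs_mul,
      mul_assoc]
    gcongr

theorem IsCorrector.zero : IsCorrector w (fun _ _ => 0) (fun _ _ => 0) :=
  ⟨0, le_rfl, fun _ _ _ _ _ => by simp, fun D t _ _ _ _ _ _ _ _ _ _ _ _ _ =>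
    ⟨0, hasDerivWithinAt_const t D 0, by simp⟩⟩

theorem IsCorrector.sum {κ : Type*} (s : Finset κ) {q p : κ → (ι → ℝ) → (ι → ℝ) → ℝ}
    (h : ∀ j ∈ s, IsCorrector w (q j) (p j)) :
    IsCorrector w (fun S C => ∑ j ∈ s, q j S C) (fun S C => ∑ j ∈ s, p j S C) := by
  classical
  induction s using Finset.induction_on with
  | empty => simpa using IsCorrector.zero
  | insert a s ha ih =>
    simp only [Finset.sum_insert ha]
    exact (h a (Finset.mem_insert_self a s)).add
      (ih fun j hj => h j (Finset.mem_insert_of_mem hj))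

theorem IsCorrector.exists_congr {q p p' : (ι → ℝ) → (ι → ℝ) → ℝ} (h : IsCorrector w q p)
    (hp : ∀ S C, p' S C = p S C) : ∃ q, IsCorrector w q p' := by
  obtain rfl : p' = p := funext fun S => funext fun C => hp S C
  exact ⟨q, h⟩

/-- The target is S² - C² + SC, which has zero mean under rotation and so is a combination of the
derivatives of SC and C². -/
theorem exists_isCorrector_diag (i : ι) (hw : w i ≠ 0) :
    ∃ q, IsCorrector w q (fun S C => 2 * ((S i + C i / 2) * S i) - (S i ^ 2 + C i ^ 2)) := by
  refine (((IsCorrector.mul_SC (w := w) i i).add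
    ((IsCorrector.mul_CC i i).const_mul (1 / 2))).const_mul (w i)⁻¹).exists_congr fun S C => ?_
  field_simp
  ring

/-- Products at frequencies w i and w k oscillate at the sum and difference frequencies. Inverting
the rotation therefore divides by w k² - w i², which is nonzero exactly because the positive
frequencies differ. -/
theorem exists_isCorrector_offDiag (i k : ι) (hi : 0 < w i) (hk : 0 < w k) (hik : w i ≠ w k) :
    ∃ q, IsCorrector w q (fun S C => (S i + C i / 2) * S k) := by
  have h : w k ^ 2 - w i ^ 2 ≠ 0 := by
    intro h
    have : (w k - w i) * (w k + w i) = 0 := by linarith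
    rcases mul_eq_zero.1 this with h1 | h1
    · exact hik (sub_eq_zero.1 h1).symm
    · linarith
  refine (((((IsCorrector.mul_SC (w := w) i k).const_mul (w k)).add
    ((IsCorrector.mul_SC k i).const_mul (-w i))).add
    (((IsCorrector.mul_CC i k).const_mul (w k / 2)).add
      ((IsCorrector.mul_SS i k).const_mul (w i / 2)))).const_mul (w k ^ 2 - w i ^ 2)⁻¹).exists_congr
        fun S C => ?_
  rw [eq_inv_mul_iff_mul_eq₀ h]
  ring

/-- Only the diagonal terms have a mean: √(2w)·√(2w)/w = 2 and S² averages to (S² + C²)/2, which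
leaves S² + C². -/
theorem exists_isCorrector [Fintype ι] (hw : ∀ i, 0 < w i) (hinj : Function.Injective w) :
    ∃ q, IsCorrector w q (fun S C =>
      (∑ k, √(2 * w k) * S k) * (∑ i, √(2 * w i) / w i * (S i + C i / 2)) -
        ∑ i, (S i ^ 2 + C i ^ 2)) := by
  classical
  have hpair : ∀ i k, ∃ q, IsCorrector w q (fun S C =>
      √(2 * w k) * S k * (√(2 * w i) / w i * (S i + C i / 2)) -
        if i = k then S i ^ 2 + C i ^ 2 else 0) := by
    intro i k
    by_cases hik : i = k
    · subst hik
      obtain ⟨q, hq⟩ := exists_isCorrector_diag i (hw i).ne'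
      refine hq.exists_congr fun S C => ?_
      have h1 : √(2 * w i) * √(2 * w i) = 2 * w i :=
        Real.mul_self_sqrt (by have := hw i; positivity)
      have h2 : √(2 * w i) * (√(2 * w i) / w i) = 2 := by
        rw [← mul_div_assoc, h1, mul_div_assoc, div_self (hw i).ne', mul_one]
      rw [if_pos rfl]
      linear_combination (h2 * S i * (S i + C i / 2))
    · obtain ⟨q, hq⟩ := exists_isCorrector_offDiag i k (hw i) (hw k) (hinj.ne hik)
      refine (hq.const_mul (√(2 * w k) * (√(2 * w i) / w i))).exists_congr fun S C => ?_
      rw [if_neg hik]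
      ring
  choose q hq using hpair
  refine (IsCorrector.sum Finset.univ fun i _ => IsCorrector.sum Finset.univ fun k _ =>
    hq i k).exists_congr fun S C => ?_
  rw [Finset.sum_mul_sum, Finset.sum_comm]
  simp [Finset.sum_sub_distrib]

end Corrector

end ExtremumSeeking

namespace ExtremumSeeking

/-! ### Derivatives along solutions in the slow coordinate. -/

section Lyapunov

open scoped InnerProductSpace
open Real (sin cos log)

variable {E : Type*} [NormedAddCommGroup E] [InnerProductSpace ℝ E]

/-- `cos θ b₀ + sin θ b₁`. -/
noncomputable def rotCos (b : Fin 2 → E) (θ : ℝ) : E := cos θ • b 0 + sin θ • b 1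

/-- `sin θ b₀ - cos θ b₁`. -/
noncomputable def rotSin (b : Fin 2 → E) (θ : ℝ) : E := sin θ • b 0 - cos θ • b 1

theorem norm_rotCos_le (b : Fin 2 → E) (θ : ℝ) : ‖rotCos b θ‖ ≤ ‖b 0‖ + ‖b 1‖ := by
  refine (norm_add_le _ _).trans ?_
  rw [norm_smul, norm_smul]
  exact add_le_add (mul_le_of_le_one_left (norm_nonneg _) (Real.abs_cos_le_one θ))
    (mul_le_of_le_one_left (norm_nonneg _) (Real.abs_sin_le_one θ))

theorem norm_rotSin_le (b : Fin 2 → E) (θ : ℝ) : ‖rotSin b θ‖ ≤ ‖b 0‖ + ‖b 1‖ := by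
  refine (norm_sub_le _ _).trans ?_
  rw [norm_smul, norm_smul]
  exact add_le_add (mul_le_of_le_one_left (norm_nonneg _) (Real.abs_sin_le_one θ))
    (mul_le_of_le_one_left (norm_nonneg _) (Real.abs_cos_le_one θ))

/-- The pair is rotated orthogonally, so the averaged decrease does not depend on the phase. -/
theorem inner_rot_sq_add_sq (b : Fin 2 → E) (θ : ℝ) (g : E) :
    ⟪rotCos b θ, g⟫_ℝ ^ 2 + ⟪rotSin b θ, g⟫_ℝ ^ 2 = ⟪b 0, g⟫_ℝ ^ 2 + ⟪b 1, g⟫_ℝ ^ 2 := by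
  simp only [rotCos, rotSin, inner_add_left, inner_sub_left, real_inner_smul_left]
  linear_combination (⟪b 0, g⟫_ℝ ^ 2 + ⟪b 1, g⟫_ℝ ^ 2) * Real.sin_sq_add_cos_sq θ

variable {D : Set ℝ} {t : ℝ}

theorem hasDerivWithinAt_rotCos (b : Fin 2 → E) {θ : ℝ → ℝ} {θ' : ℝ}
    (h : HasDerivWithinAt θ θ' D t) :
    HasDerivWithinAt (fun s => rotCos b (θ s)) (-θ' • rotSin b (θ t)) D t := by
  have := (h.cos.smul_const (b 0)).add (h.sin.smul_const (b 1))
  refine this.congr_deriv ?_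
  simp only [rotSin]
  module

theorem hasDerivWithinAt_rotSin (b : Fin 2 → E) {θ : ℝ → ℝ} {θ' : ℝ}
    (h : HasDerivWithinAt θ θ' D t) :
    HasDerivWithinAt (fun s => rotSin b (θ s)) (θ' • rotCos b (θ t)) D t := by
  have := (h.sin.smul_const (b 0)).sub (h.cos.smul_const (b 1))
  refine this.congr_deriv ?_
  simp only [rotCos]
  module

theorem norm_sum_smul_le {ι : Type*} [Fintype ι] {a : ι → ℝ} {v : ι → E} {B : ℝ}
    (ha : ∀ i, 0 ≤ a i) (hv : ∀ i, ‖v i‖ ≤ B) : ‖∑ i, a i • v i‖ ≤ (∑ i, a i) * B := by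
  rw [Finset.sum_mul]
  refine norm_sum_le_of_le _ fun i _ => ?_
  rw [norm_smul, Real.norm_of_nonneg (ha i)]
  exact mul_le_mul_of_nonneg_left (hv i) (ha i)

variable {ι : Type*} [Fintype ι]

/-- The direction of the oscillating input at cost value `y` and fast time `τ`. -/
noncomputable def inputDir (b : ι → Fin 2 → E) (w : ι → ℝ) (y τ : ℝ) : E :=
  ∑ i, √(2 * w i) • rotCos (b i) (log y + w i * τ)

/-- The direction of the antiderivative in `τ` of the oscillating input. -/
noncomputable def primitiveDir (b : ι → Fin 2 → E) (w : ι → ℝ) (y τ : ℝ) : E :=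
  ∑ i, (√(2 * w i) / w i) • rotSin (b i) (log y + w i * τ)

/-- `2 √y` times the derivative in `y` of `√y • primitiveDir`. -/
noncomputable def responseDir (b : ι → Fin 2 → E) (w : ι → ℝ) (y τ : ℝ) : E :=
  ∑ i, (√(2 * w i) / w i) •
    (rotCos (b i) (log y + w i * τ) + (1 / 2 : ℝ) • rotSin (b i) (log y + w i * τ))

variable {b : ι → Fin 2 → E} {w : ι → ℝ}

theorem hasDerivWithinAt_phase {y τ : ℝ → ℝ} {y' e : ℝ} (hy : HasDerivWithinAt y y' D t)
    (hτ : HasDerivWithinAt τ e D t) (hpos : 0 < y t) (a : ℝ) :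
    HasDerivWithinAt (fun s => log (y s) + a * τ s) (y' / y t + a * e) D t :=
  (hy.log hpos.ne').add (hτ.const_mul a)

theorem hasDerivWithinAt_primitive (hw : ∀ i, 0 < w i) {y τ : ℝ → ℝ} {y' e : ℝ}
    (hy : HasDerivWithinAt y y' D t) (hτ : HasDerivWithinAt τ e D t) (hpos : 0 < y t) :
    HasDerivWithinAt (fun s => √(y s) • primitiveDir b w (y s) (τ s))
      ((e * √(y t)) • inputDir b w (y t) (τ t) +
        (y' / √(y t)) • responseDir b w (y t) (τ t)) D t := by
  have h1 : HasDerivWithinAt (fun s => primitiveDir b w (y s) (τ s))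
      (∑ i, (√(2 * w i) / w i) • ((y' / y t + w i * e) • rotCos (b i) (log (y t) + w i * τ t)))
      D t := by
    unfold primitiveDir
    refine HasDerivWithinAt.fun_sum fun i _ => ?_
    exact (hasDerivWithinAt_rotSin (b i) (hasDerivWithinAt_phase hy hτ hpos (w i))).const_smul _
  refine ((hy.sqrt hpos.ne').smul h1).congr_deriv ?_
  have hs : 0 < √(y t) := Real.sqrt_pos.2 hpos
  have hss : √(y t) * √(y t) = y t := Real.mul_self_sqrt hpos.le
  simp only [primitiveDir, inputDir, responseDir, Finset.smul_sum, ← Finset.sum_add_distrib]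
  refine Finset.sum_congr rfl fun i _ => ?_
  have hwi := (hw i).ne'
  have e1 : √(y t) * (√(2 * w i) / w i * (y' / y t + w i * e)) =
      e * √(y t) * √(2 * w i) + y' / √(y t) * (√(2 * w i) / w i) := by
    generalize √(y t) = r at hs hss
    rw [← hss]
    field_simp
    ring
  simp only [smul_smul, smul_add]
  rw [e1]
  have e2 : y' / (2 * √(y t)) * (√(2 * w i) / w i) =
      y' / √(y t) * (√(2 * w i) / w i * (1 / 2)) := by
    field_simp
  rw [e2]
  module

variable [CompleteSpace E] {J : E → ℝ} {b₀ : E → E} {ε : ℝ} {X : ℝ → E} {τ : ℝ → ℝ}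

theorem hasDerivWithinAt_cost (hJ : ContDiff ℝ 2 J) {v : E} (hX : HasDerivWithinAt X v D t) :
    HasDerivWithinAt (fun s => J (X s)) ⟪gradient J (X t), v⟫_ℝ D t :=
  (hasFDerivAt_gradient hJ (X t)).comp_hasDerivWithinAt t hX

/-- In the coordinate `X - ε U`, with `U` the antiderivative of the input, the dynamics are slow. -/
theorem hasDerivWithinAt_slow (hw : ∀ i, 0 < w i) (hJ : ContDiff ℝ 2 J) (hε : ε ≠ 0)
    (hX : HasDerivWithinAt X
      (b₀ (X t) + ε⁻¹ • √(J (X t)) • inputDir b w (J (X t)) (τ t)) D t)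
    (hτ : HasDerivWithinAt τ (ε ^ 2)⁻¹ D t) (hpos : 0 < J (X t)) :
    HasDerivWithinAt (fun s => X s - ε • √(J (X s)) • primitiveDir b w (J (X s)) (τ s))
      (b₀ (X t) - (ε * ⟪gradient J (X t), b₀ (X t)⟫_ℝ / √(J (X t)) +
        ⟪inputDir b w (J (X t)) (τ t), gradient J (X t)⟫_ℝ) •
          responseDir b w (J (X t)) (τ t)) D t := by
  have h := hX.sub ((hasDerivWithinAt_primitive (b := b) hw (hasDerivWithinAt_cost hJ hX) hτ
    hpos).const_smul ε)
  refine h.congr_deriv ?_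
  have hs : √(J (X t)) ≠ 0 := (Real.sqrt_pos.2 hpos).ne'
  rw [inner_add_right, real_inner_smul_right, real_inner_smul_right,
    real_inner_comm (inputDir b w (J (X t)) (τ t))]
  -- This is the term that cancels the fast input. In `e2` the factor ε meets the ε⁻¹ in the
  -- derivative of J, which leaves the order-one term that averages to a gradient descent.
  have e1 : ε * ((ε ^ 2)⁻¹ * √(J (X t))) = ε⁻¹ * √(J (X t)) := by
    field_simp
  have e2 : ∀ A B : ℝ, ε * ((A + ε⁻¹ * (√(J (X t)) * B)) / √(J (X t))) =
      ε * A / √(J (X t)) + B := fun A B => by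
    field_simp
  rw [smul_add, smul_smul, smul_smul, e1, smul_smul, e2]
  abel

/-- The derivative is split as `IsCorrector` requires: rotation at rate a * e, then a remainder
caused by the motion of X. -/
theorem hasDerivWithinAt_inner_rotCos (hJ : ContDiff ℝ 2 J) {v : E}
    (hX : HasDerivWithinAt X v D t) {e : ℝ} (hτ : HasDerivWithinAt τ e D t)
    (hpos : 0 < J (X t)) (b : Fin 2 → E) (a : ℝ) :
    HasDerivWithinAt
      (fun s => ⟪rotCos b (log (J (X s)) + a * τ s), gradient J (X s)⟫_ℝ)
      (-(a * e * ⟪rotSin b (log (J (X t)) + a * τ t), gradient J (X t)⟫_ℝ) +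
        (-(⟪gradient J (X t), v⟫_ℝ / J (X t)) *
          ⟪rotSin b (log (J (X t)) + a * τ t), gradient J (X t)⟫_ℝ +
        ⟪rotCos b (log (J (X t)) + a * τ t), fderiv ℝ (gradient J) (X t) v⟫_ℝ)) D t := by
  have h1 := hasDerivWithinAt_rotCos b
    (hasDerivWithinAt_phase (hasDerivWithinAt_cost hJ hX) hτ hpos a)
  have h2 := (differentiable_gradient hJ (X t)).hasFDerivAt.comp_hasDerivWithinAt t hX
  refine (h1.inner ℝ h2).congr_deriv ?_
  rw [real_inner_smul_left]
  ring_nf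
  rfl

theorem hasDerivWithinAt_inner_rotSin (hJ : ContDiff ℝ 2 J) {v : E}
    (hX : HasDerivWithinAt X v D t) {e : ℝ} (hτ : HasDerivWithinAt τ e D t)
    (hpos : 0 < J (X t)) (b : Fin 2 → E) (a : ℝ) :
    HasDerivWithinAt
      (fun s => ⟪rotSin b (log (J (X s)) + a * τ s), gradient J (X s)⟫_ℝ)
      (a * e * ⟪rotCos b (log (J (X t)) + a * τ t), gradient J (X t)⟫_ℝ +
        ((⟪gradient J (X t), v⟫_ℝ / J (X t)) *
          ⟪rotCos b (log (J (X t)) + a * τ t), gradient J (X t)⟫_ℝ +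
        ⟪rotSin b (log (J (X t)) + a * τ t), fderiv ℝ (gradient J) (X t) v⟫_ℝ)) D t := by
  have h1 := hasDerivWithinAt_rotSin b
    (hasDerivWithinAt_phase (hasDerivWithinAt_cost hJ hX) hτ hpos a)
  have h2 := (differentiable_gradient hJ (X t)).hasFDerivAt.comp_hasDerivWithinAt t hX
  refine (h1.inner ℝ h2).congr_deriv ?_
  rw [real_inner_smul_left]
  ring_nf
  rfl

end Lyapunov

end ExtremumSeeking

namespace ExtremumSeeking

/-! ### The perturbed Lyapunov function. -/

section Estimate

open scoped InnerProductSpace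
open Real (sin cos log)

variable {E : Type*} [NormedAddCommGroup E] [InnerProductSpace ℝ E]
  {ι : Type*} [Fintype ι]

theorem abs_inner_le {u v : E} {A B : ℝ} (hu : ‖u‖ ≤ A) (hv : ‖v‖ ≤ B) : |⟪u, v⟫_ℝ| ≤ A * B :=
  (abs_real_inner_le_norm u v).trans
    (mul_le_mul hu hv (norm_nonneg _) ((norm_nonneg _).trans hu))

theorem sq_mul_le_of_abs_sub_le {ε d p K β κ A N : ℝ} (hε : 0 < ε)
    (h : |d - (ε ^ 2)⁻¹ * p| ≤ K * (β * (κ * N) * (ε⁻¹ * (A * N)))) :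
    ε ^ 2 * d ≤ p + ε * (K * (β * κ * A) * N ^ 2) := by
  have h1 := mul_le_mul_of_nonneg_left (abs_le.1 h).2 (sq_nonneg ε)
  have h2 : ε ^ 2 * (d - (ε ^ 2)⁻¹ * p) = ε ^ 2 * d - p := by field_simp
  have h3 : ε ^ 2 * (K * (β * (κ * N) * (ε⁻¹ * (A * N)))) = ε * (K * (β * κ * A) * N ^ 2) := by
    field_simp
  rw [h2, h3] at h1
  linarith

variable [CompleteSpace E]

set_option maxHeartbeats 800000 in
/-- The perturbed Lyapunov function: up to relative errors of order `ε` it equals `J - Js` and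
decreases along solutions like the averaged system. -/
theorem exists_perturbed_lyapunov {b : ι → Fin 2 → E} {w : ι → ℝ} (hw : ∀ i, 0 < w i)
    (hinj : Function.Injective w) {b₀ : E → E} {J : E → ℝ} {Js L κ κ₃ m M c : ℝ}
    (hJ : ContDiff ℝ 2 J) (hL : ∀ x, ‖fderiv ℝ (gradient J) x‖ ≤ L) (hL0 : 0 ≤ L)
    (hκ0 : 0 ≤ κ) (hκ : ∀ x, ‖gradient J x‖ ≤ κ * √(J x - Js))
    (hκ₃ : 0 ≤ κ₃) (hb₀ : ∀ x, ‖b₀ x‖ ≤ κ₃ * ‖gradient J x‖) (hc : 0 < c) (hm : 0 < m)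
    (hM : 0 ≤ M) (hmJ : ∀ x, c ≤ J x - Js → m * √(J x - Js) ≤ √(J x))
    (hMJ : ∀ x, c ≤ J x - Js → √(J x) ≤ M * √(J x - Js)) :
    ∃ K : ℝ, 0 < K ∧ ∃ W : ℝ → E → ℝ → ℝ, ∀ ε : ℝ, 0 < ε → ε ≤ 1 →
      ∀ (D : Set ℝ) (X : ℝ → E) (τ : ℝ → ℝ) (t : ℝ),
      HasDerivWithinAt X
        (b₀ (X t) + ε⁻¹ • √(J (X t)) • inputDir b w (J (X t)) (τ t)) D t →
      HasDerivWithinAt τ (ε ^ 2)⁻¹ D t → c ≤ J (X t) - Js →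
      |W ε (X t) (τ t) - (J (X t) - Js)| ≤ K * ε * (J (X t) - Js) ∧
      ∃ d, HasDerivWithinAt (fun s => W ε (X s) (τ s)) d D t ∧
        d ≤ ⟪gradient J (X t), b₀ (X t)⟫_ℝ -
          ∑ i, (⟪b i 0, gradient J (X t)⟫_ℝ ^ 2 + ⟪b i 1, gradient J (X t)⟫_ℝ ^ 2) +
          K * ε * (J (X t) - Js) := by
  obtain ⟨q, K₁, hK₁, hqb, hqd⟩ := exists_isCorrector hw hinj
  let θ : E → ℝ → ι → ℝ := fun x σ i => log (J x) + w i * σ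
  let S : E → ℝ → ι → ℝ := fun x σ i => ⟪rotCos (b i) (θ x σ i), gradient J x⟫_ℝ
  let C : E → ℝ → ι → ℝ := fun x σ i => ⟪rotSin (b i) (θ x σ i), gradient J x⟫_ℝ
  let Z : ℝ → E → ℝ → E := fun ε x σ => x - ε • √(J x) • primitiveDir b w (J x) σ
  obtain ⟨β, hβ0, hβ⟩ : ∃ β : ℝ, 0 ≤ β ∧ ∀ i, ‖b i 0‖ + ‖b i 1‖ ≤ β :=
    ⟨∑ i, (‖b i 0‖ + ‖b i 1‖), by positivity, fun i =>
      Finset.single_le_sum (f := fun i => ‖b i 0‖ + ‖b i 1‖) (fun j _ => by positivity)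
        (Finset.mem_univ i)⟩
  have hrc : ∀ i θ, ‖rotCos (b i) θ‖ ≤ β := fun i θ => (norm_rotCos_le _ _).trans (hβ i)
  have hrs : ∀ i θ, ‖rotSin (b i) θ‖ ≤ β := fun i θ => (norm_rotSin_le _ _).trans (hβ i)
  have ha : ∀ i, 0 ≤ √(2 * w i) / w i := fun i => by have := hw i; positivity
  obtain ⟨Au, hAu0, hAu⟩ : ∃ A : ℝ, 0 ≤ A ∧ ∀ y σ, ‖inputDir b w y σ‖ ≤ A :=
    ⟨(∑ i, √(2 * w i)) * β, by positivity, fun y σ =>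
      norm_sum_smul_le (fun i => Real.sqrt_nonneg _) fun i => hrc i _⟩
  obtain ⟨AU, hAU0, hAU⟩ : ∃ A : ℝ, 0 ≤ A ∧ ∀ y σ, ‖primitiveDir b w y σ‖ ≤ A :=
    ⟨(∑ i, √(2 * w i) / w i) * β, mul_nonneg (Finset.sum_nonneg fun i _ => ha i) hβ0, fun y σ =>
      norm_sum_smul_le ha fun i => hrs i _⟩
  obtain ⟨AP, hAP0, hAP⟩ : ∃ A : ℝ, 0 ≤ A ∧ ∀ y σ, ‖responseDir b w y σ‖ ≤ A := by
    refine ⟨(∑ i, √(2 * w i) / w i) * (β + 1 / 2 * β),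
      mul_nonneg (Finset.sum_nonneg fun i _ => ha i) (by positivity), fun y σ =>
      norm_sum_smul_le ha fun i => (norm_add_le _ _).trans (add_le_add (hrc i _) ?_)⟩
    rw [norm_smul, Real.norm_of_nonneg (by norm_num)]
    exact mul_le_mul_of_nonneg_left (hrs i _) (by norm_num)
  -- With N = √(J - Js): ε⁻¹ `Av` N bounds the velocity, ε⁻¹ `AR` N the rotation remainders, `Aζ` N
  -- the coefficient of the response, and `Az` N the slow velocity. `KV` and `KD` collect the errors
  -- in W and in its derivative.
  set Av := κ₃ * κ + M * Au with hAv
  set AR := κ * Av / m ^ 2 * (β * κ) + β * (L * Av) with hAR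
  set Aζ := κ * (κ₃ * κ) / m + Au * κ with hAζ
  set Az := κ₃ * κ + Aζ * AP with hAz
  have hAv0 : 0 ≤ Av := by positivity
  have hAR0 : 0 ≤ AR := by positivity
  have hAζ0 : 0 ≤ Aζ := by positivity
  have hAz0 : 0 ≤ Az := by positivity
  set KV := κ * (M * AU) + L * (M * AU) ^ 2 + K₁ * (β * κ) ^ 2 with hKV
  set KD := L * (M * AU) * Az + κ * (κ₃ * κ) / m * (AP * κ) + K₁ * (β * κ * AR) with hKD
  have hKV0 : 0 ≤ KV := by positivity
  have hKD0 : 0 ≤ KD := by positivity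
  refine ⟨KV + KD + 1, by positivity,
    fun ε x σ => J (Z ε x σ) - Js + ε ^ 2 * q (S x σ) (C x σ), ?_⟩
  intro ε hε hε1 D X τ t hX hτ hct
  set x := X t with hx
  set σ := τ t with hσ
  set g := gradient J x with hg
  set N := √(J x - Js) with hN
  have hV0 : 0 < J x - Js := hc.trans_le hct
  have hN0 : 0 < N := Real.sqrt_pos.2 hV0
  have hNN : N ^ 2 = J x - Js := Real.sq_sqrt hV0.le
  set s := √(J x) with hs
  have hs1 : m * N ≤ s := hmJ x hct
  have hs2 : s ≤ M * N := hMJ x hct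
  have hs0 : 0 < s := lt_of_lt_of_le (by positivity) hs1
  have hy : 0 < J x := Real.sqrt_pos.1 hs0
  have hss : s ^ 2 = J x := Real.sq_sqrt hy.le
  have hgN : ‖g‖ ≤ κ * N := hκ x
  have hb₀N : ‖b₀ x‖ ≤ κ₃ * κ * N := by
    rw [mul_assoc]
    exact (hb₀ x).trans (mul_le_mul_of_nonneg_left hgN hκ₃)
  have hgb : |⟪g, b₀ x⟫_ℝ| ≤ κ * N * (κ₃ * κ * N) := abs_inner_le hgN hb₀N
  have hεinv : 1 ≤ ε⁻¹ := (one_le_inv₀ hε).2 hε1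
  set v := b₀ x + ε⁻¹ • s • inputDir b w (J x) σ with hv
  have hvN : ‖v‖ ≤ ε⁻¹ * (Av * N) := by
    refine (norm_add_le _ _).trans ?_
    rw [norm_smul, norm_smul, Real.norm_of_nonneg hs0.le, Real.norm_of_nonneg (by positivity)]
    have h1 : s * ‖inputDir b w (J x) σ‖ ≤ M * N * Au := by
      gcongr
      exact hAu _ _
    calc ‖b₀ x‖ + ε⁻¹ * (s * ‖inputDir b w (J x) σ‖)
        ≤ ε⁻¹ * (κ₃ * κ * N) + ε⁻¹ * (M * N * Au) := by
          gcongr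
          exact hb₀N.trans (le_mul_of_one_le_left (by positivity) hεinv)
      _ = ε⁻¹ * (Av * N) := by rw [hAv]; ring
  -- The phase drift from log J stays of order ε⁻¹ because numerator and denominator are both
  -- quadratic in N; the lower bound m N ≤ √J is essential here.
  have hratio : |⟪g, v⟫_ℝ / J x| ≤ ε⁻¹ * (κ * Av / m ^ 2) := by
    rw [abs_div, abs_of_pos hy, div_le_iff₀ hy]
    refine (abs_inner_le hgN hvN).trans ?_
    have h1 : (m * N) ^ 2 ≤ J x := by rw [← hss]; gcongr
    calc κ * N * (ε⁻¹ * (Av * N)) = ε⁻¹ * (κ * Av / m ^ 2) * (m * N) ^ 2 := by field_simp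
      _ ≤ _ := by gcongr
  have hDg : ‖fderiv ℝ (gradient J) x v‖ ≤ L * (ε⁻¹ * (Av * N)) :=
    ((fderiv ℝ (gradient J) x).le_opNorm v).trans
      (mul_le_mul (hL x) hvN (norm_nonneg _) hL0)
  have hSB : ∀ i, |S x σ i| ≤ β * (κ * N) := fun i => abs_inner_le (hrc i _) hgN
  have hCB : ∀ i, |C x σ i| ≤ β * (κ * N) := fun i => abs_inner_le (hrs i _) hgN
  have hrem : ∀ a A r : ℝ, |a| ≤ ε⁻¹ * (κ * Av / m ^ 2) → |A| ≤ β * (κ * N) →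
      |r| ≤ β * (L * (ε⁻¹ * (Av * N))) → |a * A + r| ≤ ε⁻¹ * (AR * N) := by
    intro a A r h1 h2 h3
    refine (abs_add_le _ _).trans ((add_le_add (abs_mul_le_of_abs_le h1 h2) h3).trans_eq ?_)
    rw [hAR]
    ring
  obtain ⟨dq, hdq, hdqb⟩ := hqd D t (fun s => S (X s) (τ s)) (fun s => C (X s) (τ s)) (ε ^ 2)⁻¹
    (fun i => -(⟪g, v⟫_ℝ / J x) * C x σ i +
      ⟪rotCos (b i) (θ x σ i), fderiv ℝ (gradient J) x v⟫_ℝ)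
    (fun i => (⟪g, v⟫_ℝ / J x) * S x σ i +
      ⟪rotSin (b i) (θ x σ i), fderiv ℝ (gradient J) x v⟫_ℝ)
    (β * (κ * N)) (ε⁻¹ * (AR * N)) hSB hCB
    (fun i => hrem _ _ _ (by rw [abs_neg]; exact hratio) (hCB i) (abs_inner_le (hrc i _) hDg))
    (fun i => hrem _ _ _ hratio (hSB i) (abs_inner_le (hrs i _) hDg))
    (fun i => hasDerivWithinAt_inner_rotCos hJ hX hτ hy (b i) (w i))
    (fun i => hasDerivWithinAt_inner_rotSin hJ hX hτ hy (b i) (w i))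
  have hZ := hasDerivWithinAt_slow hw hJ hε.ne' hX hτ hy
  set P := responseDir b w (J x) σ with hP
  set u := inputDir b w (J x) σ with hu
  set ζ := ε * ⟪g, b₀ x⟫_ℝ / s + ⟪u, g⟫_ℝ with hζ
  set z := Z ε x σ with hz
  have hzx : ‖z - x‖ ≤ ε * (M * AU * N) := by
    rw [hz]
    simp only [Z]
    rw [sub_sub_cancel_left, norm_neg, norm_smul, norm_smul, Real.norm_of_nonneg hε.le,
      Real.norm_of_nonneg (Real.sqrt_nonneg _)]
    calc ε * (s * ‖primitiveDir b w (J x) σ‖) ≤ ε * (M * N * AU) := by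
          gcongr
          exact hAU _ _
      _ = _ := by ring
  have hgbs : |ε * ⟪g, b₀ x⟫_ℝ / s| ≤ ε * (κ * (κ₃ * κ) / m * N) := by
    rw [abs_div, abs_mul, abs_of_pos hε, abs_of_pos hs0, div_le_iff₀ hs0]
    calc ε * |⟪g, b₀ x⟫_ℝ| ≤ ε * (κ * N * (κ₃ * κ * N)) := by gcongr
      _ = ε * (κ * (κ₃ * κ) / m * N) * (m * N) := by field_simp
      _ ≤ _ := by gcongr
  have hζN : |ζ| ≤ Aζ * N := by
    have h1 : ε * (κ * (κ₃ * κ) / m * N) ≤ κ * (κ₃ * κ) / m * N :=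
      mul_le_of_le_one_left (by positivity) hε1
    refine (abs_add_le _ _).trans ((add_le_add (hgbs.trans h1)
      (abs_inner_le (hAu _ _) hgN)).trans_eq ?_)
    rw [hAζ]
    ring
  have hz'N : ‖b₀ x - ζ • P‖ ≤ Az * N := by
    refine (norm_sub_le _ _).trans ?_
    rw [norm_smul, Real.norm_eq_abs]
    calc ‖b₀ x‖ + |ζ| * ‖P‖ ≤ κ₃ * κ * N + Aζ * N * AP := by
          gcongr
          exact hAP _ _
      _ = Az * N := by rw [hAz]; ring
  constructor
  · have hT := abs_taylor_le hJ hL x z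
    have h1 : |⟪g, z - x⟫_ℝ| ≤ κ * N * (ε * (M * AU * N)) := abs_inner_le hgN hzx
    have h2 : |q (S x σ) (C x σ)| ≤ K₁ * (β * (κ * N)) ^ 2 := hqb _ _ _ hSB hCB
    have h3 : L * ‖z - x‖ ^ 2 ≤ ε * (L * (M * AU) ^ 2 * N ^ 2) := by
      calc L * ‖z - x‖ ^ 2 ≤ L * (ε * (M * AU * N)) ^ 2 := by gcongr
        _ = ε * (ε * (L * (M * AU) ^ 2 * N ^ 2)) := by ring
        _ ≤ ε * (1 * (L * (M * AU) ^ 2 * N ^ 2)) := by gcongr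
        _ = _ := by ring
    have h4 : |ε ^ 2 * q (S x σ) (C x σ)| ≤ ε * (K₁ * (β * κ) ^ 2 * N ^ 2) := by
      rw [abs_mul, abs_of_pos (by positivity : 0 < ε ^ 2)]
      calc ε ^ 2 * |q (S x σ) (C x σ)| ≤ ε ^ 2 * (K₁ * (β * (κ * N)) ^ 2) := by gcongr
        _ = ε * (ε * (K₁ * (β * κ) ^ 2 * N ^ 2)) := by ring
        _ ≤ ε * (1 * (K₁ * (β * κ) ^ 2 * N ^ 2)) := by gcongr
        _ = _ := by ring
    have h5 : J z - Js + ε ^ 2 * q (S x σ) (C x σ) - (J x - Js) =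
        (J z - J x - ⟪g, z - x⟫_ℝ) + ⟪g, z - x⟫_ℝ + ε ^ 2 * q (S x σ) (C x σ) := by ring
    change |J z - Js + ε ^ 2 * q (S x σ) (C x σ) - (J x - Js)| ≤ _
    rw [h5]
    refine (abs_add_three _ _ _).trans ?_
    rw [← hNN]
    have h6 : 0 ≤ ε * ((KD + 1) * N ^ 2) := by positivity
    calc _ ≤ ε * (L * (M * AU) ^ 2 * N ^ 2) + κ * N * (ε * (M * AU * N)) +
          ε * (K₁ * (β * κ) ^ 2 * N ^ 2) := add_le_add_three (hT.trans h3) h1 h4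
      _ = ε * (KV * N ^ 2) := by rw [hKV]; ring
      _ ≤ ε * (KV * N ^ 2) + ε * ((KD + 1) * N ^ 2) := by linarith
      _ = _ := by ring
  · have hJZ : HasDerivWithinAt (fun s => J (Z ε (X s) (τ s)))
        ⟪gradient J z, b₀ x - ζ • P⟫_ℝ D t := hasDerivWithinAt_cost hJ hZ
    refine ⟨_, (hJZ.sub_const Js).add (hdq.const_mul (ε ^ 2)), ?_⟩
    have hSC : ∀ i, S x σ i ^ 2 + C x σ i ^ 2 = ⟪b i 0, g⟫_ℝ ^ 2 + ⟪b i 1, g⟫_ℝ ^ 2 :=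
      fun i => inner_rot_sq_add_sq _ _ _
    have hug : ⟪u, g⟫_ℝ = ∑ k, √(2 * w k) * S x σ k := by
      simp only [hu, inputDir, sum_inner, real_inner_smul_left]
      rfl
    have hPg : ⟪P, g⟫_ℝ = ∑ i, √(2 * w i) / w i * (S x σ i + C x σ i / 2) := by
      simp only [hP, responseDir, sum_inner, real_inner_smul_left, inner_add_left]
      refine Finset.sum_congr rfl fun i _ => ?_
      simp only [S, C, θ]
      ring
    dsimp only at hdqb
    rw [← hx, ← hσ, ← hug, ← hPg] at hdqb
    simp only [hSC] at hdqb
    set Q := ∑ i, (⟪b i 0, g⟫_ℝ ^ 2 + ⟪b i 1, g⟫_ℝ ^ 2) with hQ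
    -- The oscillating product here cancels the one in `h6`, which leaves only the mean -Q.
    have h1 : ε ^ 2 * dq ≤ ⟪u, g⟫_ℝ * ⟪P, g⟫_ℝ - Q + ε * (K₁ * (β * κ * AR) * N ^ 2) :=
      sq_mul_le_of_abs_sub_le hε hdqb
    have h6 : ⟪gradient J z, b₀ x - ζ • P⟫_ℝ = ⟪gradient J z - g, b₀ x - ζ • P⟫_ℝ +
        (⟪g, b₀ x⟫_ℝ - ε * ⟪g, b₀ x⟫_ℝ / s * ⟪P, g⟫_ℝ - ⟪u, g⟫_ℝ * ⟪P, g⟫_ℝ) := by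
      rw [inner_sub_left, inner_sub_right g, real_inner_smul_right, real_inner_comm P g, hζ]
      ring
    have h7 : ⟪gradient J z - g, b₀ x - ζ • P⟫_ℝ ≤ ε * (L * (M * AU) * Az * N ^ 2) := by
      refine ((le_abs_self _).trans (abs_inner_le ((norm_gradient_sub_le hJ hL x z).trans
        (mul_le_mul_of_nonneg_left hzx hL0)) hz'N)).trans_eq ?_
      ring
    have h8 : -(ε * ⟪g, b₀ x⟫_ℝ / s * ⟪P, g⟫_ℝ) ≤ ε * (κ * (κ₃ * κ) / m * (AP * κ) * N ^ 2) := by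
      refine ((neg_le_abs _).trans (abs_mul_le_of_abs_le hgbs
        (abs_inner_le (hAP _ _) hgN))).trans_eq ?_
      ring
    rw [h6, ← hNN]
    have h9 : 0 ≤ ε * ((KV + 1) * N ^ 2) := by positivity
    have h10 : (KV + KD + 1) * ε * N ^ 2 = ε * (L * (M * AU) * Az * N ^ 2) +
        ε * (κ * (κ₃ * κ) / m * (AP * κ) * N ^ 2) + ε * (K₁ * (β * κ * AR) * N ^ 2) +
        ε * ((KV + 1) * N ^ 2) := by rw [hKD]; ring
    linarith

end Estimate

end ExtremumSeeking

namespace ExtremumSeeking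

/-! ### A scalar comparison argument. -/

section Comparison

open Set

theorem antitoneOn_of_hasDerivWithinAt_nonpos {D : Set ℝ} {f : ℝ → ℝ} {a b : ℝ}
    (hD : Icc a b ⊆ D) (h : ∀ s ∈ Icc a b, ∃ d ≤ 0, HasDerivWithinAt f d D s) :
    AntitoneOn f (Icc a b) := by
  have h1 : ∀ s ∈ Ioo a b, ∃ d ≤ 0, HasDerivAt f d s := fun s hs => by
    obtain ⟨d, hd, hs'⟩ := h s (Ioo_subset_Icc_self hs)
    exact ⟨d, hd, (hs'.mono hD).hasDerivAt (Icc_mem_nhds hs.1 hs.2)⟩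
  refine antitoneOn_of_deriv_nonpos (convex_Icc a b) (fun s hs => ?_) ?_ ?_
  · obtain ⟨d, -, hd⟩ := h s hs
    exact (hd.mono hD).continuousWithinAt
  · rw [interior_Icc]
    intro s hs
    obtain ⟨d, -, hd⟩ := h1 s hs
    exact hd.differentiableAt.differentiableWithinAt
  · rw [interior_Icc]
    intro s hs
    obtain ⟨d, hd0, hd⟩ := h1 s hs
    rwa [hd.deriv]

/-- If `W` is a perturbation of `V` that decreases at rate `k V * V` as long as `V ≥ c`, then `V`
is either small or has decayed at the corresponding rate. -/
theorem le_or_decay {D : Set ℝ} (hD : D.OrdConnected) (h0 : (0 : ℝ) ∈ D) {V W k : ℝ → ℝ} {c : ℝ}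
    (hV : ContinuousOn V D) (hc : 0 < c) (hk : MonotoneOn k (Ici 0)) (hk0 : ∀ v, 0 ≤ k v)
    (hW : ∀ t ∈ D, c ≤ V t → |W t - V t| ≤ V t / 2 ∧
      ∃ d, HasDerivWithinAt W d D t ∧ d ≤ -(k (V t) * V t)) {t : ℝ} (ht : t ∈ D) (ht0 : 0 ≤ t) :
    V t ≤ 3 * c ∨ V t / 3 * Real.exp (2 / 3 * k (V t / 3) * t) ≤ V 0 := by
  rw [or_iff_not_imp_left, not_le]
  intro hlarge
  have hsub : Icc 0 t ⊆ D := hD.out h0 ht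
  have hlow : ∀ s ∈ D, c ≤ V s → V s / 2 ≤ W s ∧ W s ≤ 3 / 2 * V s := fun s hs hcs => by
    have := abs_le.1 (hW s hs hcs).1
    exact ⟨by linarith, by linarith⟩
  have hanti : ∀ a, 0 ≤ a → (∀ s ∈ Icc a t, c ≤ V s) → AntitoneOn W (Icc a t) := by
    intro a ha hs
    have hsub' : Icc a t ⊆ D := (Icc_subset_Icc_left ha).trans hsub
    refine antitoneOn_of_hasDerivWithinAt_nonpos hsub' fun s hsa => ?_
    obtain ⟨-, d, hd, hd'⟩ := hW s (hsub' hsa) (hs s hsa)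
    have := hk0 (V s)
    have := hc.trans_le (hs s hsa)
    exact ⟨d, hd'.trans (neg_nonpos.2 (by positivity)), hd⟩
  have hct : c ≤ V t := by linarith
  -- If V had been at most c, then from the last such time on W would decrease from at most 3c/2,
  -- forcing V t ≤ 3c.
  by_cases hA : ∃ s ∈ Icc 0 t, V s ≤ c
  · exfalso
    have hcl : IsCompact {s ∈ Icc 0 t | V s ≤ c} :=
      isCompact_Icc.of_isClosed_subset
        ((hV.mono hsub).preimage_isClosed_of_isClosed isClosed_Icc isClosed_Iic)
        fun s hs => hs.1
    obtain ⟨a, ⟨haI, hac⟩, hmax⟩ := hcl.exists_isGreatest hA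
    have hgt : ∀ s ∈ Icc a t, s ≠ a → c < V s := fun s hs hne => by
      by_contra! hle
      exact hne (le_antisymm (hmax ⟨⟨haI.1.trans hs.1, hs.2⟩, hle⟩) hs.1)
    have hVa : V a = c := by
      obtain ⟨s, hs, hsc⟩ := intermediate_value_Icc haI.2
        (hV.mono ((Icc_subset_Icc_left haI.1).trans hsub)) ⟨hac, hct⟩
      by_cases hne : s = a
      · rwa [← hne]
      · exact absurd hsc (hgt s hs hne).ne'
    have hge : ∀ s ∈ Icc a t, c ≤ V s := fun s hs => by
      by_cases hne : s = a
      · rw [hne, hVa]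
      · exact (hgt s hs hne).le
    have h1 := hanti a haI.1 hge (left_mem_Icc.2 haI.2) (right_mem_Icc.2 haI.2) haI.2
    have h2 := (hlow t ht hct).1
    have h3 := (hlow a (hsub haI) hVa.ge).2
    linarith
  · push Not at hA
    have hge : ∀ s ∈ Icc 0 t, c ≤ V s := fun s hs => (hA s hs).le
    have hWa := hanti 0 le_rfl hge
    -- Since W decreases and lies between V/2 and 3V/2, V s ≥ V t / 3 at all earlier times. The rate
    -- can therefore be frozen at V t / 3, and the factor 2/3 passes from V to W.
    set r := 2 / 3 * k (V t / 3) with hr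
    have hr0 : 0 ≤ r := by have := hk0 (V t / 3); positivity
    have hf : AntitoneOn (fun s => W s * Real.exp (r * s)) (Icc 0 t) := by
      refine antitoneOn_of_hasDerivWithinAt_nonpos hsub fun s hs => ?_
      obtain ⟨-, d, hd, hd'⟩ := hW s (hsub hs) (hge s hs)
      have hexp : HasDerivWithinAt (fun s => Real.exp (r * s)) (Real.exp (r * s) * (r * 1)) D s :=
        ((hasDerivWithinAt_id s D).const_mul r).exp
      refine ⟨_, ?_, hd.mul hexp⟩
      have hws := hlow s (hsub hs) (hge s hs)
      have hwt := (hlow t ht hct).1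
      have hst := hWa hs (right_mem_Icc.2 ht0) hs.2
      have hVs : 0 < V s := hc.trans_le (hge s hs)
      have hks : k (V t / 3) ≤ k (V s) :=
        hk (by rw [mem_Ici]; linarith) hVs.le (by linarith)
      have h1 : r * W s ≤ k (V s) * V s := by
        calc r * W s ≤ r * (3 / 2 * V s) := by gcongr; exact hws.2
          _ = k (V t / 3) * V s := by rw [hr]; ring
          _ ≤ _ := by gcongr
      have h2 : d * Real.exp (r * s) + W s * (Real.exp (r * s) * (r * 1)) =
          (d + r * W s) * Real.exp (r * s) := by ring
      rw [h2]
      exact mul_nonpos_of_nonpos_of_nonneg (by linarith) (Real.exp_pos _).le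
    have h1 := hf (left_mem_Icc.2 ht0) (right_mem_Icc.2 ht0) ht0
    simp only [mul_zero, Real.exp_zero, mul_one] at h1
    have h2 := (hlow t ht hct).1
    have h3 := (hlow 0 h0 (hge 0 (left_mem_Icc.2 ht0))).2
    have h4 : V t / 2 * Real.exp (r * t) ≤ W t * Real.exp (r * t) := by gcongr
    linarith

end Comparison

/-! ### The feedback law and continuity of the closed loop. -/

section ClosedLoop

open Filter Topology
open Real (sin cos log)

theorem feedback_eq {ω : ℝ} (hω : 0 < ω) (j : Fin 2) (y τ : ℝ) :
    feedback ω j y τ = √(2 * ω) * √y *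
      (if j = 0 then cos (log y + ω * τ) else sin (log y + ω * τ)) := by
  unfold feedback
  split_ifs with h
  · rw [Real.sqrt_mul (by positivity)]
  · rw [Real.sqrt_mul (by positivity)]
  all_goals simp [Real.sqrt_eq_zero_of_nonpos (not_lt.1 h)]

/-- At y ≤ 0 the phase may be discontinuous, but the amplitude √y tends to 0 and the trigonometric
factor is bounded. -/
theorem continuous_feedback {ω : ℝ} (hω : 0 < ω) (j : Fin 2) :
    Continuous fun p : ℝ × ℝ => feedback ω j p.1 p.2 := by
  simp only [feedback_eq hω]
  rw [continuous_iff_continuousAt]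
  rintro ⟨y, τ⟩
  rcases lt_or_ge 0 y with hy | hy
  · have h1 : ContinuousAt (fun p : ℝ × ℝ => log p.1 + ω * p.2) (y, τ) :=
      (continuousAt_fst.log hy.ne').add (by fun_prop)
    have h2 : ContinuousAt (fun p : ℝ × ℝ => √(2 * ω) * √p.1) (y, τ) := by fun_prop
    refine h2.mul ?_
    split_ifs
    · exact Real.continuous_cos.continuousAt.comp h1
    · exact Real.continuous_sin.continuousAt.comp h1
  · have h0 : √y = 0 := Real.sqrt_eq_zero_of_nonpos hy
    rw [ContinuousAt, h0, mul_zero, zero_mul]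
    refine squeeze_zero_norm (a := fun p : ℝ × ℝ => √(2 * ω) * √p.1) (fun p => ?_) ?_
    · rw [norm_mul, Real.norm_of_nonneg (by positivity)]
      refine mul_le_of_le_one_right (by positivity) ?_
      split_ifs
      · exact Real.abs_cos_le_one _
      · exact Real.abs_sin_le_one _
    · have h2 : Continuous (fun p : ℝ × ℝ => √(2 * ω) * √p.1) := by fun_prop
      have := h2.tendsto (y, τ)
      simpa [h0] using this

variable {n r : ℕ} {b₀ : EuclideanSpace ℝ (Fin n) → EuclideanSpace ℝ (Fin n)}
  {b : Fin r → Fin 2 → EuclideanSpace ℝ (Fin n)} {ω : Fin r → ℚ}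
  {J : EuclideanSpace ℝ (Fin n) → ℝ} {xs : EuclideanSpace ℝ (Fin n)}

theorem closedLoop_eq (hω : ∀ i, 0 < ω i) (ε : ℝ) (x : EuclideanSpace ℝ (Fin n)) (τ : ℝ) :
    closedLoop b₀ b ω J xs ε x τ = b₀ (x + xs) +
      ε⁻¹ • √(J (x + xs)) • inputDir b (fun i => (ω i : ℝ)) (J (x + xs)) τ := by
  have hω' : ∀ i, (0 : ℝ) < ω i := fun i => by exact_mod_cast hω i
  simp only [closedLoop, inputDir, Fin.sum_univ_two, feedback_eq (hω' _)]
  congr 2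
  rw [Finset.smul_sum]
  refine Finset.sum_congr rfl fun i _ => ?_
  simp only [if_true, one_ne_zero, if_false, rotCos]
  module

theorem continuous_closedLoop (hω : ∀ i, 0 < ω i) (hb₀ : Continuous b₀) (hJ : Continuous J)
    (ε : ℝ) : Continuous (Function.uncurry (closedLoop b₀ b ω J xs ε)) := by
  have hω' : ∀ i, (0 : ℝ) < ω i := fun i => by exact_mod_cast hω i
  have h1 : ∀ i j, Continuous fun p : EuclideanSpace ℝ (Fin n) × ℝ =>
      feedback (ω i) j (J (p.1 + xs)) p.2 := fun i j =>
    (continuous_feedback (hω' i) j).comp (f := fun p : EuclideanSpace ℝ (Fin n) × ℝ =>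
      (J (p.1 + xs), p.2)) (by fun_prop)
  change Continuous fun p : EuclideanSpace ℝ (Fin n) × ℝ => b₀ (p.1 + xs) +
    ε⁻¹ • ∑ i, ∑ j, feedback (ω i : ℝ) j (J (p.1 + xs)) p.2 • b i j
  fun_prop

end ClosedLoop

end ExtremumSeeking

namespace ExtremumSeeking

open Set Filter Topology

/-! ### Facts on comparison functions and the reduction to bounds. -/

theorem IsClassK.nonneg {α : ℝ → ℝ} (h : IsClassK α) {s : ℝ} (hs : 0 ≤ s) : 0 ≤ α s := by
  have := h.strictMonoOn.monotoneOn self_mem_Ici hs hs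
  rwa [h.map_zero] at this

theorem IsClassK.pos {α : ℝ → ℝ} (h : IsClassK α) {s : ℝ} (hs : 0 < s) : 0 < α s := by
  have := h.strictMonoOn self_mem_Ici hs.le hs
  rwa [h.map_zero] at this

/-- α may be bounded; the factor s² supplies the growth, since α s ≥ α 1 > 0 for s ≥ 1. -/
theorem IsClassK.sq_mul_sq_div {α : ℝ → ℝ} (h : IsClassK α) {A : ℝ} (hA : 0 < A) :
    IsClassKInf fun s => α s ^ 2 * s ^ 2 / A := by
  refine ⟨⟨?_, ?_, by simp⟩, ?_⟩
  · exact ((h.continuousOn.pow 2).mul (by fun_prop)).div_const A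
  · intro s hs t ht hst
    rw [mem_Ici] at hs
    have h1 := h.strictMonoOn hs ht hst
    have h2 := h.nonneg hs
    have h3 : α s * s < α t * t := mul_lt_mul'' h1 hst h2 hs
    have h4 : 0 ≤ α s * s := mul_nonneg h2 hs
    dsimp only
    rw [← mul_pow, ← mul_pow]
    gcongr
  · have h1 := h.pos one_pos
    refine tendsto_atTop_mono' _ ?_ (((tendsto_pow_atTop two_ne_zero).const_mul_atTop
      (by positivity : 0 < α 1 ^ 2)).atTop_div_const hA)
    filter_upwards [eventually_ge_atTop 1] with s hs
    have : α 1 ≤ α s := h.strictMonoOn.monotoneOn (mem_Ici.2 zero_le_one)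
      (mem_Ici.2 (zero_le_one.trans hs)) hs
    gcongr

section Bounds

variable {β : ℝ → ℝ → ℝ}

theorem IsClassKL.nonneg (hβ : IsClassKL β) {r t : ℝ} (hr : 0 ≤ r) (ht : 0 ≤ t) : 0 ≤ β r t :=
  (hβ.classKInf t ht).toIsClassK.nonneg hr

theorem IsClassKL.le_zero_time (hβ : IsClassKL β) {r t : ℝ} (hr : 0 ≤ r) (ht : 0 ≤ t) :
    β r t ≤ β r 0 := by
  rcases hr.eq_or_lt with rfl | hr
  · rw [(hβ.classKInf t ht).map_zero, (hβ.classKInf 0 le_rfl).map_zero]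
  · exact (hβ.strictAntiOn r hr).antitoneOn self_mem_Ici ht ht

theorem solutionsBounded_of_le {E : Type*} [NormedAddCommGroup E] [NormedSpace ℝ E]
    [FiniteDimensional ℝ E] {f : ℝ → E → ℝ → E} {ε Δ : ℝ}
    (hf : Continuous (Function.uncurry (f ε))) (hβ : IsClassKL β) (hΔ : 0 ≤ Δ)
    (h : ∀ (x₀ : E) (τ₀ : ℝ) (T : EReal) (x : ℝ → E) (τ : ℝ → ℝ), IsSolution f ε x₀ τ₀ T x τ →
      ∀ t ∈ timeDomain T, ‖x t‖ ≤ Δ ∨ ‖x t‖ ≤ β ‖x₀‖ t) :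
    SolutionsBounded f ε β Δ := by
  intro x₀ τ₀ _ T x τ
  have hle : IsSolution f ε x₀ τ₀ T x τ → ∀ t ∈ timeDomain T, ‖x t‖ ≤ β ‖x₀‖ t + Δ := by
    intro hs t ht
    have := hβ.nonneg (norm_nonneg x₀) ht.1
    rcases h x₀ τ₀ T x τ hs t ht with h | h <;> linarith
  refine ⟨hle, fun hmax => hmax.eq_top_of_bounded hf (R := β ‖x₀‖ 0 + Δ) fun t ht => ?_⟩
  have := hle hmax.1 t ht
  have := hβ.le_zero_time (norm_nonneg x₀) ht.1
  linarith

end Bounds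

/-! ### Decay of the cost and the uniform KL bound. -/

section Main

open scoped InnerProductSpace

variable {n r : ℕ} {b₀ : EuclideanSpace ℝ (Fin n) → EuclideanSpace ℝ (Fin n)}
  {b : Fin r → Fin 2 → EuclideanSpace ℝ (Fin n)} {ω : Fin r → ℚ}
  {J : EuclideanSpace ℝ (Fin n) → ℝ} {xs : EuclideanSpace ℝ (Fin n)}
  {γ κ₃ L : ℝ} {α : ℝ → ℝ}

/-- Above each level `c` with `J xs + c > 0`, the cost decays for all small `ε` at a rate that
depends neither on `c` nor on `ε`. -/
theorem exists_cost_le_or_decay (hω_pos : ∀ i, 0 < ω i) (hω_inj : Function.Injective ω)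
    (hκ₃ : 0 < κ₃) (hγ : κ₃ < γ)
    (hb : ∀ v, γ * ‖v‖ ^ 2 ≤ ∑ i, ∑ j, (inner ℝ (b i j) v) ^ 2)
    (hJ : ContDiff ℝ 2 J) (hmin : ∀ x, J xs ≤ J x) (hcrit : gradient J xs = 0)
    (hL0 : 0 < L) (hL : ∀ x, ‖fderiv ℝ (gradient J) x‖ ≤ L)
    (hb₀ : ∀ x, ‖b₀ x‖ ≤ κ₃ * ‖gradient J x‖) (hα : IsClassK α)
    (hgrad : ∀ x, α ‖x - xs‖ ^ 2 * ‖x - xs‖ ^ 2 ≤ ‖gradient J x‖ ^ 2)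
    {c : ℝ} (hc : 0 < c) (hcJ : 0 < J xs + c) :
    ∃ εs : ℝ, 0 < εs ∧ ∀ ε : ℝ, 0 < ε → ε < εs → ∀ x₀ τ₀ T x τ,
      IsSolution (closedLoop b₀ b ω J xs) ε x₀ τ₀ T x τ → ∀ t ∈ timeDomain T,
      J (x t + xs) - J xs ≤ 3 * c ∨ (J (x t + xs) - J xs) / 3 *
        Real.exp (2 / 3 * ((γ - κ₃) / (2 * L) * α √((J (x t + xs) - J xs) / 3 / L) ^ 2) * t) ≤
          J (x₀ + xs) - J xs := by
  have hω : ∀ i, (0 : ℝ) < ω i := fun i => by exact_mod_cast hω_pos i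
  have hinj : Function.Injective fun i => (ω i : ℝ) := Rat.cast_injective.comp hω_inj
  have hγκ : 0 < γ - κ₃ := sub_pos.2 hγ
  -- This is half of the available decay rate; the other half absorbs the error K ε V.
  let k : ℝ → ℝ := fun v => (γ - κ₃) / (2 * L) * α √(v / L) ^ 2
  have hk0 : ∀ v, 0 ≤ k v := fun v => by positivity
  have hk : MonotoneOn k (Ici 0) := by
    intro v hv v' hv' hle
    have h1 : α √(v / L) ≤ α √(v' / L) :=
      hα.strictMonoOn.monotoneOn (Real.sqrt_nonneg _) (Real.sqrt_nonneg _) (by gcongr)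
    have h2 := hα.nonneg (Real.sqrt_nonneg (v / L))
    simp only [k]
    gcongr
  have hkc : 0 < k c := by
    have := hα.pos (Real.sqrt_pos.2 (div_pos hc hL0))
    simp only [k]
    positivity
  have hgk : ∀ x, c ≤ J x - J xs →
      2 * (k (J x - J xs) * (J x - J xs)) ≤ (γ - κ₃) * ‖gradient J x‖ ^ 2 := by
    intro x hx
    set V := J x - J xs
    have hV : 0 < V := hc.trans_le hx
    have h1 : V / L ≤ ‖x - xs‖ ^ 2 := by
      rw [div_le_iff₀ hL0, mul_comm]
      exact sub_min_le hJ hL hcrit x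
    have h2 : √(V / L) ≤ ‖x - xs‖ := Real.sqrt_le_left (norm_nonneg _) |>.2 h1
    have h3 : α √(V / L) ≤ α ‖x - xs‖ :=
      hα.strictMonoOn.monotoneOn (Real.sqrt_nonneg _) (norm_nonneg _) h2
    have h4 := hα.nonneg (Real.sqrt_nonneg (V / L))
    calc 2 * (k V * V) = (γ - κ₃) * (α √(V / L) ^ 2 * (V / L)) := by
          simp only [k]
          field_simp
      _ ≤ (γ - κ₃) * (α ‖x - xs‖ ^ 2 * ‖x - xs‖ ^ 2) := by gcongr
      _ ≤ _ := by
          gcongr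
          exact hgrad x
  have hκ : ∀ x, ‖gradient J x‖ ≤ √(4 * L) * √(J x - J xs) := by
    intro x
    rw [← Real.sqrt_mul (by positivity)]
    exact Real.le_sqrt_of_sq_le (norm_gradient_sq_le hJ hL hL0 hmin x)
  have hm0 : 0 < min 1 ((J xs + c) / c) := lt_min one_pos (div_pos hcJ hc)
  -- The choices of m and M come from J = V + J xs with V ≥ c: the ratio J / V lies between min 1 (1
  -- + J xs / c) and 1 + |J xs| / c.
  obtain ⟨K, hK, W, hW⟩ := exists_perturbed_lyapunov (b := b) (w := fun i => (ω i : ℝ)) hω hinj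
    (b₀ := b₀) (Js := J xs) (κ := √(4 * L)) (κ₃ := κ₃)
    (m := √(min 1 ((J xs + c) / c))) (M := √(1 + |J xs| / c)) (c := c) hJ hL hL0.le
    (Real.sqrt_nonneg _) hκ hκ₃.le hb₀ hc (Real.sqrt_pos.2 hm0) (Real.sqrt_nonneg _)
    (fun x hx => by
      rw [← Real.sqrt_mul hm0.le]
      refine Real.sqrt_le_sqrt ?_
      set V := J x - J xs with hV
      have hV0 : 0 < V := hc.trans_le hx
      rcases le_total 0 (J xs) with hs | hs
      · calc min 1 ((J xs + c) / c) * V ≤ 1 * V := by gcongr; exact min_le_left _ _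
          _ ≤ J x := by linarith
      · calc min 1 ((J xs + c) / c) * V ≤ (J xs + c) / c * V := by gcongr; exact min_le_right _ _
          _ = V + J xs * (V / c) := by field_simp; ring
          _ ≤ V + J xs * 1 := by
            have : 1 ≤ V / c := (one_le_div hc).2 hx
            linarith [mul_le_mul_of_nonpos_left this hs]
          _ = J x := by rw [hV]; ring)
    (fun x hx => by
      rw [← Real.sqrt_mul (by positivity)]
      refine Real.sqrt_le_sqrt ?_
      have : |J xs| ≤ |J xs| / c * (J x - J xs) := by
        calc |J xs| = |J xs| / c * c := by field_simp
          _ ≤ _ := by gcongr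
      linarith [le_abs_self (J xs)])
  -- The bound K ε ≤ 1/2 gives |W - V| ≤ V/2. The bound K ε ≤ k c ≤ k V lets half of the decay
  -- absorb the error for every V ≥ c.
  refine ⟨min 1 (min (1 / 2) (k c) / K), lt_min one_pos (div_pos (lt_min (by norm_num) hkc) hK),
    fun ε hε hεs x₀ τ₀ T x τ hsol t ht => ?_⟩
  have hε1 : ε ≤ 1 := (hεs.trans_le (min_le_left _ _)).le
  have hεK : K * ε ≤ min (1 / 2) (k c) := by
    have := (hεs.trans_le (min_le_right _ _)).le
    rwa [le_div_iff₀ hK, mul_comm] at this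
  have hX : ∀ s ∈ timeDomain T, HasDerivWithinAt (fun s => x s + xs)
      (b₀ (x s + xs) + ε⁻¹ • √(J (x s + xs)) •
        inputDir b (fun i => (ω i : ℝ)) (J (x s + xs)) (τ s)) (timeDomain T) s := fun s hs => by
    have := (hsol.deriv_x s hs).add_const xs
    rwa [closedLoop_eq hω_pos] at this
  have hVc : ContinuousOn (fun s => J (x s + xs) - J xs) (timeDomain T) := fun s hs =>
    ((hasDerivWithinAt_cost hJ (hX s hs)).continuousWithinAt).sub continuousWithinAt_const
  have key := le_or_decay (ordConnected_timeDomain T) hsol.zero_mem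
    (V := fun s => J (x s + xs) - J xs) (W := fun s => W ε (x s + xs) (τ s)) (k := k) hVc hc hk hk0
    (fun s hs hcs => ?_) ht ht.1
  · simpa only [k, hsol.init_x] using key
  · obtain ⟨h1, d, hd, hd'⟩ := hW ε hε hε1 (timeDomain T) (fun s => x s + xs) τ s (hX s hs)
      (hsol.deriv_τ s hs) hcs
    set g := gradient J (x s + xs) with hg
    set V := J (x s + xs) - J xs with hV
    have hV0 : 0 < V := hc.trans_le hcs
    refine ⟨h1.trans ?_, d, hd, hd'.trans ?_⟩
    · have : K * ε * V ≤ 1 / 2 * V := by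
        gcongr
        exact hεK.trans (min_le_left _ _)
      linarith
    · have h2 : ⟪g, b₀ (x s + xs)⟫_ℝ ≤ κ₃ * ‖g‖ ^ 2 := by
        refine (real_inner_le_norm _ _).trans ?_
        calc ‖g‖ * ‖b₀ (x s + xs)‖ ≤ ‖g‖ * (κ₃ * ‖g‖) := by
              gcongr
              exact hb₀ _
          _ = _ := by ring
      have h3 := hb g
      simp only [Fin.sum_univ_two] at h3
      have h4 := hgk _ hcs
      rw [← hg, ← hV] at h4
      have h5 : K * ε * V ≤ k V * V := by
        gcongr
        exact (hεK.trans (min_le_right _ _)).trans (hk hc.le hV0.le hcs)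
      linarith

/-- A `KL` bound, uniform in the level `c`, outside the set where `α ‖x‖ ^ 2 * ‖x‖ ^ 2` is of the
order of `c`. -/
theorem exists_classKL_bound (hω_pos : ∀ i, 0 < ω i) (hω_inj : Function.Injective ω)
    (hκ₃ : 0 < κ₃) (hγ : κ₃ < γ)
    (hb : ∀ v, γ * ‖v‖ ^ 2 ≤ ∑ i, ∑ j, (inner ℝ (b i j) v) ^ 2)
    (hJ : ContDiff ℝ 2 J) (hmin : ∀ x, J xs ≤ J x) (hcrit : gradient J xs = 0)
    (hL0 : 0 < L) (hL : ∀ x, ‖fderiv ℝ (gradient J) x‖ ≤ L)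
    (hb₀ : ∀ x, ‖b₀ x‖ ≤ κ₃ * ‖gradient J x‖) (hα : IsClassK α)
    (hgrad : ∀ x, α ‖x - xs‖ ^ 2 * ‖x - xs‖ ^ 2 ≤ ‖gradient J x‖ ^ 2) :
    ∃ β : ℝ → ℝ → ℝ, IsClassKL β ∧ ∀ c : ℝ, 0 < c → 0 < J xs + c →
    ∃ εs : ℝ, 0 < εs ∧ ∀ ε : ℝ, 0 < ε → ε < εs → ∀ x₀ τ₀ T x τ,
      IsSolution (closedLoop b₀ b ω J xs) ε x₀ τ₀ T x τ → ∀ t ∈ timeDomain T,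
      α ‖x t‖ ^ 2 * ‖x t‖ ^ 2 / (12 * L) ≤ c ∨ ‖x t‖ ≤ β ‖x₀‖ t := by
  have hγκ : 0 < γ - κ₃ := sub_pos.2 hγ
  -- The constant 12L = 3 · 4L makes h ‖x‖ ≤ V / 3, the quantity in the decay estimate.
  have hh := hα.sq_mul_sq_div (A := 12 * L) (by positivity)
  set h : ℝ → ℝ := fun s => α s ^ 2 * s ^ 2 / (12 * L) with hdef
  have hhn : ∀ s, 0 ≤ h s := fun s => by simp only [hdef]; positivity
  let ρ : ℝ → ℝ := fun v => 2 / 3 * ((γ - κ₃) / (2 * L) * α √(v / L) ^ 2)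
  have hρ : MonotoneOn ρ (Ici 0) := by
    intro v hv v' hv' hle
    have h1 : α √(v / L) ≤ α √(v' / L) :=
      hα.strictMonoOn.monotoneOn (Real.sqrt_nonneg _) (Real.sqrt_nonneg _) (by gcongr)
    have h2 := hα.nonneg (Real.sqrt_nonneg (v / L))
    simp only [ρ]
    gcongr
  have hρc : Continuous ρ := by
    have : Continuous fun v => α √(v / L) := by
      rw [← continuousOn_univ]
      exact hα.continuousOn.comp (by fun_prop) fun v _ => Real.sqrt_nonneg _
    exact continuous_const.mul (continuous_const.mul (this.pow 2))
  obtain ⟨β, hβ, hβ'⟩ := exists_classKL_of_rate (h := h) (κ := fun s => ρ (h s)) hh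
    (hρc.comp_continuousOn hh.continuousOn)
    (fun s hs s' hs' hle => hρ (hhn s) (hhn s') (hh.strictMonoOn.monotoneOn hs hs' hle))
    (by simp only [ρ]; positivity)
    (fun s hs => by
      have h1 : 0 < h s := by
        have := hα.pos hs
        simp only [hdef]
        positivity
      have := hα.pos (Real.sqrt_pos.2 (div_pos h1 hL0))
      simp only [ρ]
      positivity) hL0
  refine ⟨β, hβ, fun c hc hcJ => ?_⟩
  obtain ⟨εs, hεs, hdecay⟩ := exists_cost_le_or_decay hω_pos hω_inj hκ₃ hγ hb hJ hmin hcrit hL0 hL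
    hb₀ hα hgrad hc hcJ
  refine ⟨εs, hεs, fun ε hε hε' x₀ τ₀ T x τ hsol t ht => ?_⟩
  set V := J (x t + xs) - J xs with hV
  have hV0 : 0 ≤ V := sub_nonneg.2 (hmin _)
  have hhV : h ‖x t‖ ≤ V / 3 := by
    have h1 := hgrad (x t + xs)
    rw [add_sub_cancel_right] at h1
    have h2 := h1.trans (norm_gradient_sq_le hJ hL hL0 hmin (x t + xs))
    simp only [hdef]
    rw [div_le_iff₀ (by positivity)]
    linarith
  rcases hdecay ε hε hε' x₀ τ₀ T x τ hsol t ht with h1 | h1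
  · left
    change h ‖x t‖ ≤ c
    linarith
  · right
    refine hβ' _ _ _ (norm_nonneg _) ht.1 (norm_nonneg _) ?_
    have h2 := sub_min_le hJ hL hcrit (x₀ + xs)
    rw [add_sub_cancel_right] at h2
    refine le_trans ?_ (h1.trans h2)
    have h3 : ρ (h ‖x t‖) ≤ ρ (V / 3) :=
      hρ (hhn _) (by rw [mem_Ici]; positivity) hhV
    have h4 : 0 ≤ t := ht.1
    calc h ‖x t‖ * Real.exp (ρ (h ‖x t‖) * t) ≤ V / 3 * Real.exp (ρ (V / 3) * t) := by gcongr
      _ = _ := rfl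

end Main

end ExtremumSeeking

/-! ### The main theorem. -/

theorem theorem2 {n r : ℕ}
    (b₀ : EuclideanSpace ℝ (Fin n) → EuclideanSpace ℝ (Fin n))
    (b : Fin r → Fin 2 → EuclideanSpace ℝ (Fin n)) (ω : Fin r → ℚ)
    (J : EuclideanSpace ℝ (Fin n) → ℝ) (xs : EuclideanSpace ℝ (Fin n))
    (γ κ₃ L_J L₀ : ℝ) (α_J : ℝ → ℝ)
    -- the frequencies are positive, rational and pairwise different
    (hω_pos : ∀ i, 0 < ω i) (hω_inj : Function.Injective ω)
    -- the excitation directions are spanning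
    (hκ₃ : 0 < κ₃) (hγ : κ₃ < γ)
    (hb : ∀ v, γ * ‖v‖ ^ 2 ≤ ∑ i, ∑ j, (inner ℝ (b i j) v) ^ 2)
    -- the cost function: smoothness, radial unboundedness, minimizer, critical point, Hessian
    (hJ : ContDiff ℝ 2 J)
    (hJ_unbdd : Filter.Tendsto J (Bornology.cobounded (EuclideanSpace ℝ (Fin n))) Filter.atTop)
    (hJ_min : ∀ x, x ≠ xs → J xs < J x)
    (hJ_crit : ∀ x, gradient J x = 0 ↔ x = xs)
    (hJ_hess : ∀ x, ‖fderiv ℝ (gradient J) x‖ ≤ L_J)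
    -- the drift
    (hb₀_bound : ∀ x, ‖b₀ x‖ ≤ κ₃ * ‖gradient J x‖)
    (hb₀_lip : ∀ x₁ x₂, ‖b₀ x₁ - b₀ x₂‖ ≤ L₀ * ‖x₁ - x₂‖)
    -- the growth of the gradient
    (hα_J : ExtremumSeeking.IsClassK α_J)
    (hJ_grad : ∀ x, α_J ‖x - xs‖ ^ 2 * ‖x - xs‖ ^ 2 ≤ ‖gradient J x‖ ^ 2) :
    ExtremumSeeking.UGUB (ExtremumSeeking.closedLoop b₀ b ω J xs) ∧
      (0 ≤ J xs → ExtremumSeeking.UGpAS (ExtremumSeeking.closedLoop b₀ b ω J xs)) := by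
  have hmin : ∀ x, J xs ≤ J x := fun x => by
    by_cases hx : x = xs
    · rw [hx]
    · exact (hJ_min x hx).le
  -- Enlarging the Hessian bound makes it strictly positive.
  have hL0 : 0 < max L_J 1 := lt_max_of_lt_right one_pos
  have hb₀c : Continuous b₀ := by
    refine (LipschitzWith.of_dist_le_mul (K := L₀.toNNReal) fun x₁ x₂ => ?_).continuous
    rw [dist_eq_norm, dist_eq_norm]
    exact (hb₀_lip x₁ x₂).trans
      (mul_le_mul_of_nonneg_right (Real.le_coe_toNNReal L₀) (norm_nonneg _))
  have hf := fun ε => ExtremumSeeking.continuous_closedLoop (b := b) (xs := xs) hω_pos hb₀c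
    hJ.continuous ε
  have hh := hα_J.sq_mul_sq_div (A := 12 * max L_J 1) (by positivity)
  obtain ⟨β, hβ, hbound⟩ := ExtremumSeeking.exists_classKL_bound hω_pos hω_inj hκ₃ hγ hb hJ hmin
    ((hJ_crit xs).2 rfl) hL0 (fun x => (hJ_hess x).trans (le_max_left _ _)) hb₀_bound hα_J hJ_grad
  have hsmall : ∀ {c Δ s : ℝ}, 0 ≤ Δ → 0 ≤ s →
      c ≤ α_J Δ ^ 2 * Δ ^ 2 / (12 * max L_J 1) →
      α_J s ^ 2 * s ^ 2 / (12 * max L_J 1) ≤ c → s ≤ Δ := fun hΔ hs h1 h2 =>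
    (hh.strictMonoOn.le_iff_le hs hΔ).1 (h2.trans h1)
  constructor
  -- This level satisfies J xs + c ≥ 1 whatever the sign of J xs; Δ is then any radius at which the
  -- K∞ function exceeds it.
  · obtain ⟨εs, hεs, hsol⟩ := hbound (|J xs| + 1) (by positivity)
      (by linarith [neg_abs_le (J xs)])
    obtain ⟨Δ, hΔ, hΔ0⟩ := ((hh.tendsto_atTop.eventually_ge_atTop (|J xs| + 1)).and
      (Filter.eventually_gt_atTop 0)).exists
    exact ⟨Δ, hΔ0, β, hβ, εs, hεs, fun ε hε hε' =>
      ExtremumSeeking.solutionsBounded_of_le (hf ε) hβ hΔ0.le fun x₀ τ₀ T x τ hs t ht =>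
        (hsol ε hε hε' x₀ τ₀ T x τ hs t ht).imp_left (hsmall hΔ0.le (norm_nonneg _) hΔ)⟩
  · intro hJs
    refine ⟨β, hβ, fun ν hν => ?_⟩
    -- The level is chosen so that its residual set is exactly the ball of radius ν; such small
    -- levels are admissible because J xs ≥ 0.
    have hc : 0 < α_J ν ^ 2 * ν ^ 2 / (12 * max L_J 1) := by
      have := hα_J.pos hν
      positivity
    obtain ⟨εs, hεs, hsol⟩ := hbound _ hc (by linarith)
    exact ⟨εs, hεs, fun ε hε hε' =>
      ExtremumSeeking.solutionsBounded_of_le (hf ε) hβ hν.le fun x₀ τ₀ T x τ hs t ht =>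
        (hsol ε hε hε' x₀ τ₀ T x τ hs t ht).imp_left (hsmall hν.le (norm_nonneg _) le_rfl)⟩
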